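/- **Setting.** Let $S$ be a finite set, $P$ a stochastic matrix on $S$ with positive invariant distribution $\pi$, and $X_t$ the continuous-time Markov chain with rates $Q=P-1$ (jumps according to $P$ after independent exponential times of mean one). Let $P^*(x,y)=\pi(y)P(y,x)/\pi(x)$ be the time-reversed kernel, with chain $X^{\leftarrow}_t$. Write $\tau_C^{\nu}=\inf\{t\ge 0: X_t\in C\}$ for the hitting time of $C$ from initial law $\nu$, $\tau^x_C$ when $\nu=\delta_x$, and $\tau_C^{\leftarrow x}$ for the reversed chain. Fix $G\subset S$, $A=S\setminus G$ and $\pi_A=\pi(\cdot\cap A)/\pi(A)$. For $\alpha\in(0,1)$, $R>1$, $f\in(0,1)$ put $$B_\alpha=\Big\{x\in A:\ \tfrac12\big[\mathbf P(\tau_G^x\le 2R)+\mathbf P(\tau_G^{\leftarrow x}\le 2R)\big]\le f^\alpha\Big\}.$$ For $d,r\in(0,1)$, condition $Hp.G(R,d,f,r)$ (with exponent $\alpha$) says that * (slow escape) $\mathbf P(\tau_G^{\pi_A}\le 2R)\le f$; * (fast thermalization) $d_{TV}\big(\mathcal L(X^x_R),\mathcal L(X^{x'}_R)\big)\le d$ for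 all $x,x'\in B_\alpha$; * (fast recurrence) $\sup_{x\in S}\mathbf P(\tau^x_{B_\alpha\cup G}>R)<r$. **Theorem.** Consider the top-in-at-random shuffle on the permutations $(x_1,\dots,x_n)$ of $n$ cards: $P$ moves $(x_1,\dots,x_n)$ to $(x_2,\dots,x_k,x_1,x_{k+1},\dots,x_n)$ with $k$ uniform in $\{1,\dots,n\}$; $\pi$ is uniform. Let $G=G^{(n)}=\{(1,\dots,n)\}$ be the ordered deck. Let $R_n>0$ satisfy $n\log n\ll R_n\ll (n-2)!$, that is, $\frac{n\log n}{R_n}\to0$ and $\frac{R_n}{(n-2)!}\to 0$. Then there are sequences $f_n\to0$ and $d_n\to0$ such that for every $\alpha\in(0,1)$: 1. there is a sequence $r_n\to0$ such that $Hp.G(R_n,d_n,f_n,r_n)$ with exponent $\alpha$ holds for all sufficiently large $n$; 2. for all probability measures $\nu_n$ on the set of decks which, for all large $n$, are supported in the set $B_\alpha=B_\alpha^{(n)}$ given by $R_n$, $f_n$ and $\alpha$, the mean $\mathbf E[\tau_G^{\nu_n}]$ is positive and finite for all large $n$, and $\tau_G^{\nu_n}/\mathbf E[\tau_G^{\nu_n}]$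 converges in law to an exponential variable of mean one. Moreover, for a well-shuffled deck, i.e. for the initial law $\pi_A$ uniform on the decks that are not ordered, the mean $\mathbf E[\tau^{\pi_A}_G]$ is positive and finite for all large $n$ and $\tau^{\pi_A}_G/\mathbf E[\tau^{\pi_A}_G]$ converges in law to an exponential variable of mean one. -/

import Mathlib

open MeasureTheory ProbabilityTheory Filter Topology
open scoped ENNReal NNReal Nat

noncomputable section

namespace Metastable

/-! ### Continuous-time Markov chains on a finite set

`P : S → PMF S` is the transition kernel of the jump chain and `Q = P - 1` is the matrix of
transition rates: after independent exponential times of mean one the chain makes a `P`-jump. -/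

variable {S : Type} [Fintype S] [MeasurableSpace S] [DiscreteMeasurableSpace S]

/-- The transition probabilities `P` as a Markov kernel. -/
def stepKernel (P : S → PMF S) : Kernel S S where
  toFun x := (P x).toMeasure
  measurable' := .of_discrete

instance (P : S → PMF S) : IsMarkovKernel (stepKernel P) :=
  ⟨fun x => inferInstanceAs (IsProbabilityMeasure (P x).toMeasure)⟩

/-- The law of the next state given the whole past `Y₀, …, Y_k`: it is `P Y_k`. -/
def historyKernel (P : S → PMF S) (k : ℕ) :
    Kernel ((i : Finset.Iic k) → (fun _ : ℕ => S) i) S :=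
  (stepKernel P).comap (fun h => h ⟨k, Finset.mem_Iic.2 le_rfl⟩) (measurable_pi_apply _)

instance (P : S → PMF S) (k : ℕ) : IsMarkovKernel (historyKernel P k) := by
  unfold historyKernel; infer_instance

/-- Sample points: the successive states of the jump chain and the successive holding times. -/
abbrev Sample (S : Type) : Type := (ℕ → S) × (ℕ → ℝ)

/-- The law of the chain with initial distribution `ν`: the jump chain is a Markov chain with
initial law `ν` and transition probabilities `P`, and the holding times are independent of it
and i.i.d. exponential of mean one. -/
def law (P : S → PMF S) (ν : Measure S) : Measure (Sample S) :=
  (Kernel.trajMeasure (X := fun _ => S) ν (historyKernel P)).prod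
    (Measure.infinitePi fun _ : ℕ => expMeasure 1)

/-- The law of the chain started at the state `x`. -/
def lawAt (P : S → PMF S) (x : S) : Measure (Sample S) := law P (Measure.dirac x)

/-- The time of the `k`-th jump (and `0` for `k = 0`). -/
def jumpTime (ω : Sample S) (k : ℕ) : ℝ := ∑ i ∈ Finset.range k, ω.2 i

/-- The number of jumps up to time `t`. -/
def jumpCount (ω : Sample S) (t : ℝ) : ℕ := sSup {k : ℕ | jumpTime ω k ≤ t}

/-- The state `X_t` of the continuous-time chain at time `t`. -/
def state (ω : Sample S) (t : ℝ) : S := ω.1 (jumpCount ω t)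

/-- The first hitting time `τ_C = inf {t ≥ 0 : X_t ∈ C}`, with `inf ∅ = ∞`. -/
def hittingTime (C : Set S) (ω : Sample S) : ℝ≥0∞ :=
  ⨅ (t : ℝ≥0) (_ : state ω t ∈ C), (t : ℝ≥0∞)

/-- `𝐏(τ_C ≤ t)` when the initial distribution is `ν`. -/
def hitProb (P : S → PMF S) (ν : Measure S) (C : Set S) (t : ℝ) : ℝ :=
  (law P ν).real {ω | hittingTime C ω ≤ ENNReal.ofReal t}

/-- `𝐄[τ_C]` when the initial distribution is `ν`. -/
def meanHittingTime (P : S → PMF S) (ν : Measure S) (C : Set S) : ℝ≥0∞ :=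
  ∫⁻ ω, hittingTime C ω ∂(law P ν)

/-- The total variation distance between the laws of `X_t` started at `x` and at `x'`. -/
def evolvedTV (P : S → PMF S) (t : ℝ) (x x' : S) : ℝ :=
  (1 / 2) * ∑ y : S,
    |(lawAt P x).real {ω | state ω t = y} - (lawAt P x').real {ω | state ω t = y}|

/-- A Markov chain together with its (positive) invariant distribution. -/
structure StationaryChain (S : Type) where
  /-- transition probabilities of the jump chain -/
  P : S → PMF S
  /-- invariant distribution -/
  π : PMF S
  pos : ∀ x, π x ≠ 0
  invariant : π.bind P = π

/-- The transition probabilities `P*(x,y) = π(y) P(y,x) / π(x)` of the time reversal. -/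
def StationaryChain.reversed (M : StationaryChain S) (x : S) : PMF S :=
  ⟨fun y => M.π y * M.P y x / M.π x, by
    have h : ∑' y, M.π y * M.P y x = M.π x := by
      rw [← PMF.bind_apply, M.invariant]
    have h' : ∑' y, M.π y * M.P y x / M.π x = 1 := by
      simp_rw [div_eq_mul_inv]
      rw [ENNReal.tsum_mul_right, h]
      exact ENNReal.mul_inv_cancel (M.pos x) (M.π.apply_ne_top x)
    exact h' ▸ ENNReal.summable.hasSum⟩

/-- The invariant measure restricted to `A` and normalised: `π_A = π(· ∩ A) / π(A)`. -/
def StationaryChain.restricted (M : StationaryChain S) (A : Set S) : Measure S :=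
  M.π.toMeasure[|A]

/-- The basin `B_α`: the points `x` outside the goal set `G` such that
`(𝐏(τ_G^x ≤ 2R) + 𝐏(τ_G^{←x} ≤ 2R)) / 2 ≤ f ^ α`. -/
def basin (M : StationaryChain S) (G : Set S) (α R f : ℝ) : Set S :=
  {x | x ∉ G ∧
    (1 / 2) * (hitProb M.P (Measure.dirac x) G (2 * R)
      + hitProb M.reversed (Measure.dirac x) G (2 * R)) ≤ f ^ α}

/-- Slow escape `E(R,f)` from `A = Gᶜ`: `𝐏(τ_G^{π_A} ≤ 2R) ≤ f`. -/
def SlowEscape (M : StationaryChain S) (G : Set S) (R f : ℝ) : Prop :=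
  hitProb M.P (M.restricted Gᶜ) G (2 * R) ≤ f

/-- Fast thermalization `T(R,d)` in `B_α`. -/
def FastThermalization (M : StationaryChain S) (G : Set S) (α R d f : ℝ) : Prop :=
  ∀ x ∈ basin M G α R f, ∀ x' ∈ basin M G α R f, evolvedTV M.P R x x' ≤ d

/-- Fast recurrence `Rc(R,r)` to `B_α ∪ G`, from every state (`S` is finite, so
that the supremum over the starting point is attained). -/
def FastRecurrence (M : StationaryChain S) (G : Set S) (α R f r : ℝ) : Prop :=
  ∀ x, (lawAt M.P x).real
    {ω | ENNReal.ofReal R < hittingTime (basin M G α R f ∪ G) ω} < r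

/-- The condition `Hp.G(R,d,f,r)` for the exponent `α` in the definition of `B_α`. -/
structure HpG (M : StationaryChain S) (G : Set S) (α R d f r : ℝ) : Prop where
  one_lt_R : 1 < R
  d_mem : d ∈ Set.Ioo (0 : ℝ) 1
  f_mem : f ∈ Set.Ioo (0 : ℝ) 1
  r_mem : r ∈ Set.Ioo (0 : ℝ) 1
  escape : SlowEscape M G R f
  thermalization : FastThermalization M G α R d f
  recurrence : FastRecurrence M G α R f r

/-! ### The top-in-at-random shuffle -/

/-- A deck of `n` cards: `x i` is the card at position `i` (positions and cards are numbered
from `0`, and position `0` is the top). The ordered deck is the identity. -/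
abbrev Deck (n : ℕ) : Type := Equiv.Perm (Fin n)

instance (n : ℕ) : MeasurableSpace (Deck n) := ⊤

instance (n : ℕ) : DiscreteMeasurableSpace (Deck n) := ⟨fun _ => trivial⟩

/-- The top card is put at position `k`: `(x₀, …, x_{n-1})` becomes
`(x₁, …, x_k, x₀, x_{k+1}, …, x_{n-1})`. -/
def shuffle {n : ℕ} (x : Deck n) (k : Fin n) : Deck n := x * k.cycleRange

open Classical in
/-- One top-in-at-random step: the top card goes to a uniform position.
(A deck without cards does not move.) -/
def tiarStep (n : ℕ) (x : Deck n) : PMF (Deck n) :=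
  if h : Nonempty (Fin n) then (PMF.uniformOfFintype (Fin n)).map (shuffle x) else PMF.pure x

/-- The uniform distribution is invariant under the top-in-at-random shuffle. -/
theorem uniform_bind_tiarStep (n : ℕ) :
    (PMF.uniformOfFintype (Deck n)).bind (tiarStep n) = PMF.uniformOfFintype (Deck n) := by
  by_cases h : Nonempty (Fin n)
  · have h1 : tiarStep n = fun x =>
        (PMF.uniformOfFintype (Fin n)).bind fun k => PMF.pure (shuffle x k) := by
      funext x
      simp only [tiarStep, h, dite_true]
      rfl
    rw [h1, PMF.bind_comm]
    have h2 : ∀ k : Fin n, ((PMF.uniformOfFintype (Deck n)).bind fun x =>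
        PMF.pure (shuffle x k)) = PMF.uniformOfFintype (Deck n) := by
      intro k
      ext y
      rw [PMF.bind_apply, tsum_eq_single (y * k.cycleRange⁻¹)]
      · simp [shuffle]
      · intro x hx
        have : y ≠ shuffle x k := fun hy => hx (by simp [hy, shuffle])
        simp [PMF.pure_apply, this]
    simp_rw [h2, PMF.bind_const]
  · have h1 : tiarStep n = PMF.pure := by
      funext x
      simp only [tiarStep, h, dite_false]
    rw [h1, PMF.bind_pure]

/-- The top-in-at-random chain on decks of `n` cards, with its uniform invariant distribution. -/
def tiar (n : ℕ) : StationaryChain (Deck n) where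
  P := tiarStep n
  π := PMF.uniformOfFintype (Deck n)
  pos x := by simp
  invariant := uniform_bind_tiarStep n

/-- The goal set: the ordered deck. -/
def ordered (n : ℕ) : Set (Deck n) := {1}

/-- For the top-in-at-random chains with initial distributions `ν n`, the mean hitting time of the
ordered deck is eventually positive and finite, and the hitting time divided by its mean
converges in law to the exponential distribution of mean one. -/
def AsymptoticallyExponential (ν : (n : ℕ) → Measure (Deck n)) : Prop :=
  (∀ᶠ n in atTop, 0 < meanHittingTime (tiar n).P (ν n) (ordered n) ∧
    meanHittingTime (tiar n).P (ν n) (ordered n) < ∞) ∧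
  ∀ t : ℝ, 0 ≤ t → Tendsto (fun n => (law (tiar n).P (ν n)).real
      {ω | ENNReal.ofReal t <
        hittingTime (ordered n) ω / meanHittingTime (tiar n).P (ν n) (ordered n)})
    atTop (𝓝 (Real.exp (-t)))

end Metastable

end

noncomputable section

namespace Metastable

/-! ### Transition operators and survival functions of the jump chain -/

section Operators

variable {S : Type}

/-! The ordered deck has stationary mass `1/n!`, whereas the shuffle forgets its starting point
within order `n log n` jumps. The scale `R` lies strictly between: within time `R` the chain has
mixed, but in the stationary regime it is unlikely to have visited the goal. Forgetting long before
hitting makes the hitting time asymptotically memoryless, hence exponential.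

Memorylessness is quantified on the jump chain. Let `a j` be the probability of avoiding `C` during
the steps `0, …, j`, and `T = ∑ a j`. If the chain has mixed after `m` steps up to an error `d`
(`MixedAt`), then `a (k + m + i)` is close to `a k` times the stationary survival probability `g i`
(`MixedAt.survival_add_le`, `MixedAt.le_survival_add`). Summing over `k`, the tail of `a` from `m +
i` is close to `T * g i`, and `g i` is close to `a (m + i)` when a visit before mixing is unlikely.
So `a` is nearly proportional to its own tails, which forces `a j ≈ (1 - 1/T)^j`
(`abs_sub_geometric_le_of_tail`). A union bound in the stationary regime gives `T ≥ n!/32`, so `m/T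
→ 0`.

Mixing comes from a coupling. From the ordered deck, top-in-at-random has the same law at each fixed
time as random-to-top (`stepOp_pow_one_eq_toTopOp_pow`). Two random-to-top shuffles that always move
the same card agree once every card has been chosen; the expected number of cards not yet chosen
after `m` steps, `n (1 - 1/n)^m`, bounds the error (`mixedAt_tiarStep`).

The clock is independent of the jump chain with unit mean holding times, so mean hitting times
coincide with mean numbers of jumps, and Chebyshev's inequality converts jumps into time. In `Hp.G`,
slow escape is the union bound, thermalization is mixing, and recurrence combines mixing with
Markov's inequality, which shows that the basin and the goal together carry nearly all the mass
(`mean_compl_basin_le`). -/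

theorem indicator_compl_one_nonneg (C : Set S) : 0 ≤ Cᶜ.indicator (1 : S → ℝ) :=
  Set.indicator_nonneg fun _ _ => zero_le_one

theorem indicator_one_le (C : Set S) : C.indicator (1 : S → ℝ) ≤ 1 :=
  Set.indicator_le_self' fun _ _ => zero_le_one

variable [Fintype S]

/-- The transition operator `(P h)(x) = ∑ y, P(x,y) h(y)` on real functions. -/
def stepOp (P : S → PMF S) : Module.End ℝ (S → ℝ) where
  toFun h x := ∑ y, (P x y).toReal * h y
  map_add' h h' := by
    funext x; simp [mul_add, Finset.sum_add_distrib]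
  map_smul' c h := by
    funext x; simp [Finset.mul_sum, mul_left_comm]

/-- The transition operator of the chain killed in `C`. -/
def killedOp (P : S → PMF S) (C : Set S) : Module.End ℝ (S → ℝ) where
  toFun h := Cᶜ.indicator (stepOp P h)
  map_add' h h' := by
    rw [map_add]; exact Set.indicator_add _ _ _
  map_smul' c h := by
    rw [map_smul]; exact Set.indicator_const_smul Cᶜ c (stepOp P h)

/-- `survival P C k x` is the probability that the jump chain started at `x` does not visit `C`
during the steps `0, …, k`. -/
def survival (P : S → PMF S) (C : Set S) (k : ℕ) : S → ℝ :=
  (killedOp P C ^ k) (Cᶜ.indicator 1)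

/-- The integral of `h` with respect to the weights `w`. -/
def mean (w : S → ℝ) : (S → ℝ) →ₗ[ℝ] ℝ where
  toFun h := ∑ x, w x * h x
  map_add' h h' := by simp [mul_add, Finset.sum_add_distrib]
  map_smul' c h := by simp [Finset.mul_sum, mul_left_comm]

theorem stepOp_apply (P : S → PMF S) (h : S → ℝ) (x : S) :
    stepOp P h x = ∑ y, (P x y).toReal * h y := rfl

theorem mean_apply (w : S → ℝ) (h : S → ℝ) : mean w h = ∑ x, w x * h x := rfl

theorem sum_toReal_eq_one (p : PMF S) : ∑ y, (p y).toReal = 1 := by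
  rw [← ENNReal.toReal_sum fun y _ => p.apply_ne_top y, ← tsum_fintype (L := .unconditional _),
    p.tsum_coe, ENNReal.toReal_one]

theorem stepOp_mono (P : S → PMF S) : Monotone (stepOp P) := fun _ _ h _ =>
  Finset.sum_le_sum fun y _ => mul_le_mul_of_nonneg_left (h y) ENNReal.toReal_nonneg

theorem stepOp_const (P : S → PMF S) (c : ℝ) : stepOp P (fun _ => c) = fun _ => c := by
  funext x
  simp [stepOp_apply, ← Finset.sum_mul, sum_toReal_eq_one]

theorem stepOp_pow_mono (P : S → PMF S) (k : ℕ) : Monotone ⇑(stepOp P ^ k) := by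
  rw [Module.End.coe_pow]; exact (stepOp_mono P).iterate k

theorem stepOp_pow_const (P : S → PMF S) (k : ℕ) (c : ℝ) :
    (stepOp P ^ k) (fun _ => c) = fun _ => c := by
  rw [Module.End.coe_pow]
  exact Function.iterate_fixed (stepOp_const P c) k

theorem stepOp_pow_mem_Icc (P : S → PMF S) (k : ℕ) {h : S → ℝ}
    (hh : h ∈ Set.Icc (0 : S → ℝ) 1) : (stepOp P ^ k) h ∈ Set.Icc (0 : S → ℝ) 1 := by
  have h0 := stepOp_pow_mono P k hh.1
  have h1 := stepOp_pow_mono P k hh.2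
  rw [show (0 : S → ℝ) = fun _ => 0 from rfl, stepOp_pow_const] at h0
  rw [show (1 : S → ℝ) = fun _ => 1 from rfl, stepOp_pow_const] at h1
  exact ⟨h0, h1⟩

theorem killedOp_apply (P : S → PMF S) (C : Set S) (h : S → ℝ) :
    killedOp P C h = Cᶜ.indicator (stepOp P h) := rfl

theorem killedOp_mono (P : S → PMF S) (C : Set S) : Monotone (killedOp P C) :=
  fun _ _ h x => Set.indicator_le_indicator (stepOp_mono P h x)

theorem killedOp_pow_mono (P : S → PMF S) (C : Set S) (k : ℕ) :
    Monotone ⇑(killedOp P C ^ k) := by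
  rw [Module.End.coe_pow]; exact (killedOp_mono P C).iterate k

theorem killedOp_pow_nonneg (P : S → PMF S) (C : Set S) (k : ℕ) {h : S → ℝ} (hh : 0 ≤ h) :
    0 ≤ (killedOp P C ^ k) h := by
  have := killedOp_pow_mono P C k hh
  rwa [map_zero] at this

/-- Killing decreases the evolution of nonnegative functions. -/
theorem killedOp_pow_le (P : S → PMF S) (C : Set S) (k : ℕ) {h : S → ℝ} (hh : 0 ≤ h) :
    (killedOp P C ^ k) h ≤ (stepOp P ^ k) h := by
  induction k with
  | zero => simp
  | succ k ih =>
    rw [pow_succ', pow_succ', Module.End.mul_apply, Module.End.mul_apply]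
    intro x
    refine le_trans ?_ (stepOp_mono P ih x)
    refine Set.indicator_le_self' (fun x _ => ?_) x
    have := stepOp_mono P (killedOp_pow_nonneg P C k hh) x
    rwa [map_zero] at this

theorem survival_zero (P : S → PMF S) (C : Set S) : survival P C 0 = Cᶜ.indicator 1 := by
  simp [survival]

theorem killedOp_pow_survival (P : S → PMF S) (C : Set S) (j k : ℕ) :
    (killedOp P C ^ j) (survival P C k) = survival P C (j + k) := by
  simp [survival, pow_add]

theorem survival_succ (P : S → PMF S) (C : Set S) (k : ℕ) :
    survival P C (k + 1) = Cᶜ.indicator (stepOp P (survival P C k)) := by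
  rw [add_comm, ← killedOp_pow_survival, pow_one, killedOp_apply]

theorem survival_nonneg (P : S → PMF S) (C : Set S) (k : ℕ) : 0 ≤ survival P C k :=
  killedOp_pow_nonneg P C k (indicator_compl_one_nonneg C)

theorem survival_of_mem (P : S → PMF S) {C : Set S} (k : ℕ) {x : S} (hx : x ∈ C) :
    survival P C k x = 0 := by
  cases k with
  | zero => simp [survival_zero, hx]
  | succ k => simp [survival_succ, hx]

theorem survival_le_one (P : S → PMF S) (C : Set S) (k : ℕ) : survival P C k ≤ 1 := by
  refine (killedOp_pow_le P C k (indicator_compl_one_nonneg C)).trans ?_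
  exact (stepOp_pow_mem_Icc P k ⟨indicator_compl_one_nonneg C, indicator_one_le Cᶜ⟩).2

theorem survival_antitone (P : S → PMF S) (C : Set S) : Antitone (survival P C) := by
  have key : survival P C 1 ≤ survival P C 0 := by
    intro x
    by_cases hx : x ∈ C
    · simp [survival_of_mem P _ hx]
    · rw [survival_zero, Set.indicator_of_mem (by exact hx)]
      exact survival_le_one P C 1 x
  refine antitone_nat_of_succ_le fun k => ?_
  have := killedOp_pow_mono P C k key
  rwa [killedOp_pow_survival, killedOp_pow_survival] at this

theorem survival_mem_Icc (P : S → PMF S) (C : Set S) (k : ℕ) :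
    survival P C k ∈ Set.Icc (0 : S → ℝ) 1 :=
  ⟨survival_nonneg P C k, survival_le_one P C k⟩

theorem mean_mono {w : S → ℝ} (hw : 0 ≤ w) : Monotone (mean w) := fun _ _ h =>
  Finset.sum_le_sum fun x _ => mul_le_mul_of_nonneg_left (h x) (hw x)

theorem mean_const {w : S → ℝ} (hw : ∑ x, w x = 1) (c : ℝ) : mean w (fun _ => c) = c := by
  simp [mean_apply, ← Finset.sum_mul, hw]

theorem mean_one {w : S → ℝ} (hw : ∑ x, w x = 1) : mean w 1 = 1 := mean_const hw 1

theorem mean_nonneg {w : S → ℝ} (hw : 0 ≤ w) {h : S → ℝ} (hh : 0 ≤ h) : 0 ≤ mean w h :=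
  Finset.sum_nonneg fun x _ => mul_nonneg (hw x) (hh x)

theorem mean_le_of_le {w : S → ℝ} (hw : 0 ≤ w) (hw1 : ∑ x, w x = 1) {h : S → ℝ} {c : ℝ}
    (hh : ∀ x, h x ≤ c) : mean w h ≤ c :=
  (mean_mono hw (show h ≤ fun _ => c from hh)).trans_eq (mean_const hw1 c)

/-- The weights `w` form an invariant probability for `P`. -/
structure InvariantWeights (P : S → PMF S) (w : S → ℝ) : Prop where
  nonneg : 0 ≤ w
  sum_eq_one : ∑ x, w x = 1
  mean_step : ∀ h, mean w (stepOp P h) = mean w h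

theorem InvariantWeights.mean_step_pow {P : S → PMF S} {w : S → ℝ} (hw : InvariantWeights P w)
    (k : ℕ) (h : S → ℝ) : mean w ((stepOp P ^ k) h) = mean w h := by
  induction k with
  | zero => simp
  | succ k ih => rw [pow_succ', Module.End.mul_apply, hw.mean_step, ih]

/-- In the stationary regime, the probability to visit `C` within `k` steps is at most
`(k + 1) π(C)`. -/
theorem InvariantWeights.one_sub_mean_survival_le {P : S → PMF S} {w : S → ℝ}
    (hw : InvariantWeights P w) (C : Set S) (k : ℕ) :
    1 - mean w (survival P C k) ≤ (k + 1) * mean w (C.indicator 1) := by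
  have hsplit : (1 : S → ℝ) = Cᶜ.indicator 1 + C.indicator 1 :=
    (Set.indicator_compl_add_self C 1).symm
  induction k with
  | zero =>
    have := mean_one hw.sum_eq_one
    rw [hsplit, map_add] at this
    rw [survival_zero]; simp; linarith
  | succ k ih =>
    -- Killing alters the step only on `C`, where the left side is at most one; under the invariant
    -- weights each further step therefore costs at most `π(C)`.
    have h1 : stepOp P (survival P C k) ≤ survival P C (k + 1) + C.indicator 1 := by
      intro x
      by_cases hx : x ∈ C
      · simp only [Pi.add_apply, survival_of_mem P _ hx, Set.indicator_of_mem hx, zero_add]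
        have := (stepOp_pow_mem_Icc P 1 (survival_mem_Icc P C k)).2 x
        simpa using this
      · simp [survival_succ, hx]
    have h2 := mean_mono hw.nonneg h1
    rw [hw.mean_step, map_add] at h2
    push_cast
    linarith

/-- After `m` steps the jump chain is within `d` of `w`, for test functions with values
in `[0,1]` and every starting point. -/
def MixedAt (P : S → PMF S) (w : S → ℝ) (m : ℕ) (d : ℝ) : Prop :=
  ∀ h ∈ Set.Icc (0 : S → ℝ) 1, ∀ x, |(stepOp P ^ m) h x - mean w h| ≤ d

/-- Extra steps can be absorbed into the test function: `P^j h` still has values in `[0,1]`, and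
invariance preserves its mean. -/
theorem MixedAt.mono {P : S → PMF S} {w : S → ℝ} {m : ℕ} {d : ℝ} (hm : MixedAt P w m d)
    (hw : InvariantWeights P w) {k : ℕ} (hk : m ≤ k) : MixedAt P w k d := by
  intro h hh x
  obtain ⟨j, rfl⟩ := Nat.exists_eq_add_of_le hk
  have := hm _ (stepOp_pow_mem_Icc P j hh) x
  rwa [hw.mean_step_pow, ← Module.End.mul_apply, ← pow_add] at this

variable {P : S → PMF S} {w : S → ℝ} {m : ℕ} {d : ℝ}

/-- Ignoring the killing during the first `m` steps can only help survival, and the remaining `k`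
steps then start close to stationarity. -/
theorem MixedAt.survival_le (hm : MixedAt P w m d) (C : Set S) (k : ℕ) (x : S) :
    survival P C (m + k) x ≤ mean w (survival P C k) + d := by
  rw [← killedOp_pow_survival]
  have h1 := killedOp_pow_le P C m (survival_nonneg P C k) x
  have h2 := (abs_le.1 (hm _ (survival_mem_Icc P C k) x)).2
  linarith

/-- The comparison of killed and unkilled evolutions is applied to `1 - survival P C k`. The only
loss besides `d` is the probability of a visit to `C` during the first `m` steps. -/
theorem MixedAt.le_survival (hm : MixedAt P w m d) (C : Set S) (k : ℕ) (x : S) :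
    mean w (survival P C k) - d - (1 - survival P C m x) ≤ survival P C (m + k) x := by
  have h1 := killedOp_pow_le P C m (sub_nonneg.2 (survival_le_one P C k)) x
  have h2 := (abs_le.1 (hm _ (survival_mem_Icc P C k) x)).1
  have h3 : survival P C m ≤ (killedOp P C ^ m) 1 :=
    killedOp_pow_mono P C m (indicator_one_le Cᶜ)
  have h4 : (stepOp P ^ m) (1 : S → ℝ) x = 1 := congrFun (stepOp_pow_const P m 1) x
  have h5 := h3 x
  rw [map_sub, map_sub, killedOp_pow_survival, Pi.sub_apply, Pi.sub_apply, h4] at h1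
  linarith

/-- On `Cᶜ` the bound of `MixedAt.survival_le` is a constant, so it can be propagated through `k`
killed steps, which is the Markov property at step `k`. -/
theorem MixedAt.survival_add_le (hm : MixedAt P w m d) (C : Set S) (j k : ℕ) :
    survival P C (k + (m + j)) ≤ (mean w (survival P C j) + d) • survival P C k := by
  have h1 : survival P C (m + j) ≤ (mean w (survival P C j) + d) • survival P C 0 := by
    intro x
    by_cases hx : x ∈ C
    · simp [survival_of_mem P _ hx]
    · simpa [survival_zero, hx] using hm.survival_le C j x
  have h2 := killedOp_pow_mono P C k h1
  rwa [map_smul, killedOp_pow_survival, killedOp_pow_survival] at h2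

/-- The probability of an early visit, after `k` killed steps, becomes the increment `survival k -
survival (k + m)`. In this form the losses telescope when summed over `k`. -/
theorem MixedAt.le_survival_add (hm : MixedAt P w m d) (C : Set S) (j k : ℕ) :
    (mean w (survival P C j) - d) • survival P C k - (survival P C k - survival P C (k + m)) ≤
      survival P C (k + (m + j)) := by
  have h1 : (mean w (survival P C j) - d) • survival P C 0
      - (survival P C 0 - survival P C m) ≤ survival P C (m + j) := by
    intro x
    by_cases hx : x ∈ C
    · simp [survival_of_mem P _ hx]
    · simpa [survival_zero, hx] using hm.le_survival C j x
  have h2 := killedOp_pow_mono P C k h1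
  rwa [map_sub, map_sub, map_smul, killedOp_pow_survival, killedOp_pow_survival,
    killedOp_pow_survival] at h2

/-- If the chain mixes to a precision finer than `π(C)`, the survival functions are summable. -/
theorem MixedAt.summable_survival (hm : MixedAt P w m d) (hw : InvariantWeights P w) (C : Set S)
    (hd : d < mean w (C.indicator 1)) (x : S) : Summable fun k => survival P C k x := by
  set ρ := mean w (survival P C 0) + d with hρ
  have hρ1 : ρ < 1 := by
    have h1 := mean_one hw.sum_eq_one
    rw [← Set.indicator_compl_add_self C (1 : S → ℝ), map_add] at h1
    rw [hρ, survival_zero]; linarith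
  have h0 : ∀ k, 0 ≤ survival P C k x := fun k => survival_nonneg P C k x
  have h1 : ∀ k, survival P C k x ≤ 1 := fun k => survival_le_one P C k x
  refine summable_of_sum_range_le (c := m / (1 - ρ)) h0 fun N => ?_
  rw [le_div_iff₀ (by linarith)]
  -- Every delay of `m` steps costs a factor `ρ < 1`, so a partial sum `s` satisfies `s ≤ m + ρ s`,
  -- a bound uniform in `N`.
  have h2 : ∑ k ∈ Finset.range N, survival P C k x
      ≤ ∑ k ∈ Finset.range m, survival P C k x
        + ∑ k ∈ Finset.range N, survival P C (m + k) x := by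
    rw [← Finset.sum_range_add]
    exact Finset.sum_le_sum_of_subset_of_nonneg
      (Finset.range_mono (Nat.le_add_left N m)) fun k _ _ => h0 k
  have h3 : ∑ k ∈ Finset.range m, survival P C k x ≤ m := by
    simpa using Finset.sum_le_sum fun k (_ : k ∈ Finset.range m) => h1 k
  have h4 : ∑ k ∈ Finset.range N, survival P C (m + k) x
      ≤ ρ * ∑ k ∈ Finset.range N, survival P C k x := by
    rw [Finset.mul_sum]
    refine Finset.sum_le_sum fun k _ => ?_
    have := hm.survival_add_le C 0 k x
    rwa [add_zero, add_comm k m] at this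
  linarith

end Operators

/-! ### Exponential approximation of the survival sequence -/

/-- A summable sequence in `[0,1]` that is proportional to its own tail sums, up to a relative
error `η`, is geometric up to an error of order `η`. -/
theorem abs_sub_geometric_le_of_tail {a : ℕ → ℝ} {T η : ℝ} (hs : HasSum a T) (hT : 1 ≤ T)
    (h : ∀ j, |a j - (∑' k, a (k + j)) / T| ≤ η) (j : ℕ) :
    |a j - (1 - 1 / T) ^ j| ≤ η * (1 + j / T) := by
  have hT0 : 0 < T := by linarith
  have hTi : 0 ≤ 1 - 1 / T := by
    rw [sub_nonneg, div_le_one hT0]; exact hT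
  have hTi1 : 1 - 1 / T ≤ 1 := by
    have : 0 ≤ 1 / T := by positivity
    linarith
  set H : ℕ → ℝ := fun j => (∑' k, a (k + j)) / T with hH
  have hrec : ∀ j, H j = a j / T + H (j + 1) := by
    intro j
    have h1 := ((summable_nat_add_iff j).2 hs.summable).sum_add_tsum_nat_add 1
    simp only [Finset.sum_range_one, zero_add] at h1
    simp only [hH]
    rw [← h1, add_div]
    congr 3
    funext k; congr 1; ring
  have key : ∀ j : ℕ, |H j - (1 - 1 / T) ^ j| ≤ j * (η / T) := by
    intro j
    induction j with
    | zero => simp [hH, hs.tsum_eq, hT0.ne']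
    | succ j ih =>
      have h1 : H (j + 1) - (1 - 1 / T) ^ (j + 1)
          = (1 - 1 / T) * (H j - (1 - 1 / T) ^ j) - (a j - H j) / T := by
        rw [eq_sub_of_add_eq' (hrec j).symm]; ring
      have h2 : |(1 - 1 / T) * (H j - (1 - 1 / T) ^ j)| ≤ j * (η / T) := by
        rw [abs_mul, abs_of_nonneg hTi]
        exact (mul_le_of_le_one_left (abs_nonneg _) hTi1).trans ih
      have h3 : |(a j - H j) / T| ≤ η / T := by
        rw [abs_div, abs_of_pos hT0]
        exact div_le_div_of_nonneg_right (h j) hT0.le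
      rw [h1]
      refine (abs_sub _ _).trans ?_
      push_cast
      linarith
  have h1 := h j
  have h2 := key j
  have h3 : η * (1 + j / T) = η + j * (η / T) := by ring
  rw [h3, show a j - (1 - 1 / T) ^ j = (a j - H j) + (H j - (1 - 1 / T) ^ j) by ring]
  exact (abs_add_le _ _).trans (add_le_add h1 h2)

section Operators

variable {S : Type} [Fintype S] {P : S → PMF S} {w v : S → ℝ} {m : ℕ} {d q T : ℝ} {C : Set S}

theorem mean_survival_mem_Icc (hv : 0 ≤ v) (hv1 : ∑ x, v x = 1) (k : ℕ) :
    mean v (survival P C k) ∈ Set.Icc (0 : ℝ) 1 :=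
  ⟨mean_nonneg hv (survival_nonneg P C k), mean_le_of_le hv hv1 (survival_le_one P C k)⟩

theorem mean_survival_antitone (hv : 0 ≤ v) : Antitone fun k => mean v (survival P C k) :=
  fun _ _ h => mean_mono hv (survival_antitone P C h)

/-- After `m` steps any starting law may be replaced by the invariant one, up to the mixing error
and the probability of an early visit. -/
theorem MixedAt.abs_mean_survival_sub_le (hm : MixedAt P w m d) (hv : 0 ≤ v)
    (hv1 : ∑ x, v x = 1) (k : ℕ) :
    |mean v (survival P C (m + k)) - mean w (survival P C k)|
      ≤ d + (1 - mean v (survival P C m)) := by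
  have hd : 0 ≤ d := by
    obtain ⟨x⟩ : Nonempty S := by
      by_contra hS
      rw [not_nonempty_iff] at hS
      simp at hv1
    exact (abs_nonneg _).trans (hm 0 ⟨le_rfl, fun _ => zero_le_one⟩ x)
  have hm1 := (mean_survival_mem_Icc (P := P) (C := C) hv hv1 m).2
  have h1 : mean v (survival P C (m + k)) ≤ mean w (survival P C k) + d :=
    mean_le_of_le hv hv1 (hm.survival_le C k)
  have h2 := mean_mono hv (show (fun _ => mean w (survival P C k) - d - 1) + survival P C m
    ≤ survival P C (m + k) from fun x => by
      have := hm.le_survival C k x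
      simp only [Pi.add_apply]; linarith)
  rw [map_add, mean_const hv1] at h2
  rw [abs_le]; constructor <;> linarith

/-- Exponential approximation: the survival probabilities of a chain started at `v` are close to
the geometric sequence with the same mean `T`, if `T` is large compared with the mixing time and
the chain is unlikely to visit `C` before mixing. -/
theorem MixedAt.abs_mean_survival_sub_geometric_le (hm : MixedAt P w m d) (hv : 0 ≤ v)
    (hv1 : ∑ x, v x = 1) (hq : 1 - mean v (survival P C m) ≤ q)
    (hs : HasSum (fun k => mean v (survival P C k)) T) (hT : 1 ≤ T) (j : ℕ) :
    |mean v (survival P C j) - (1 - 1 / T) ^ j| ≤ (2 * d + q + m / T) * (1 + j / T) := by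
  refine abs_sub_geometric_le_of_tail hs hT (fun j => ?_) j
  set a : ℕ → ℝ := fun k => mean v (survival P C k) with ha
  have hT0 : 0 < T := by linarith
  have ha0 : ∀ k, 0 ≤ a k := fun k => (mean_survival_mem_Icc hv hv1 k).1
  have ha1 : ∀ k, a k ≤ 1 := fun k => (mean_survival_mem_Icc hv hv1 k).2
  have hsj : ∀ j, Summable fun k => a (k + j) := fun j => (summable_nat_add_iff j).2 hs.summable
  have htail : ∀ j : ℕ, T - j ≤ ∑' k, a (k + j) := by
    intro j
    have h1 := hs.summable.sum_add_tsum_nat_add j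
    rw [hs.tsum_eq] at h1
    have h2 : ∑ k ∈ Finset.range j, a k ≤ j := by
      simpa using Finset.sum_le_sum fun k (_ : k ∈ Finset.range j) => ha1 k
    simp only [ha] at h1 h2 ⊢
    linarith
  have htail' : ∑' k, a (k + j) ≤ T := by
    rw [← hs.tsum_eq, ← hs.summable.sum_add_tsum_nat_add j]
    exact le_add_of_nonneg_left (Finset.sum_nonneg fun k _ => ha0 k)
  have hd : 0 ≤ d := by
    obtain ⟨x⟩ : Nonempty S := by
      by_contra hS
      rw [not_nonempty_iff] at hS
      simp at hv1
    exact (abs_nonneg _).trans (hm 0 ⟨le_rfl, fun _ => zero_le_one⟩ x)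
  have hmT : 0 ≤ (m : ℝ) / T := by positivity
  have hq0 : 0 ≤ q := by have := ha1 m; simp only [ha] at this; linarith
  -- For `j = m + i`, both `a j` and the normalised tail are compared with the stationary survival
  -- `g`. For `j < m`, both are close to one.
  by_cases hj : m ≤ j
  · obtain ⟨i, rfl⟩ := Nat.exists_eq_add_of_le hj
    have h1 := abs_le.1 (hm.abs_mean_survival_sub_le (C := C) hv hv1 i)
    set g := mean w (survival P C i) with hg
    have h2 : ∑' k, a (k + (m + i)) ≤ (g + d) * T := by
      rw [← hs.tsum_eq, ← tsum_mul_left]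
      refine (hsj _).tsum_le_tsum (fun k => ?_) (hs.summable.mul_left _)
      have := mean_mono hv (hm.survival_add_le C i k)
      rwa [map_smul, smul_eq_mul] at this
    -- The increments `a k - a (k + m)` sum to the first `m` terms of `a`, hence to at most `m`.
    have h3 : (g - d) * T - m ≤ ∑' k, a (k + (m + i)) := by
      have h4 : ∑' k, ((g - d) * a k - (a k - a (k + m))) ≤ ∑' k, a (k + (m + i)) := by
        refine Summable.tsum_le_tsum (fun k => ?_)
          ((hs.summable.mul_left _).sub (hs.summable.sub (hsj m))) (hsj _)
        have := mean_mono hv (hm.le_survival_add C i k)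
        rwa [map_sub, map_sub, map_smul, smul_eq_mul] at this
      rw [(hs.summable.mul_left _).tsum_sub (hs.summable.sub (hsj m)), tsum_mul_left,
        hs.summable.tsum_sub (hsj m), hs.tsum_eq] at h4
      have := htail m
      linarith
    have h4 : (∑' k, a (k + (m + i))) / T ≤ g + d := by rwa [div_le_iff₀ hT0]
    have h5 : g - d - m / T ≤ (∑' k, a (k + (m + i))) / T := by
      rw [le_div_iff₀ hT0, sub_mul, div_mul_cancel₀ _ hT0.ne']; exact h3
    rw [abs_le]; constructor <;> simp only [ha] at h4 h5 ⊢ <;> linarith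
  · push Not at hj
    have h1 : a m ≤ a j := mean_survival_antitone hv hj.le
    have h2 : (∑' k, a (k + j)) / T ≤ 1 := by rwa [div_le_one hT0]
    have h3 : 1 - m / T ≤ (∑' k, a (k + j)) / T := by
      rw [le_div_iff₀ hT0, sub_mul, div_mul_cancel₀ _ hT0.ne', one_mul]
      have : (j : ℝ) ≤ m := by exact_mod_cast hj.le
      linarith [htail j]
    have h4 := ha1 j
    rw [abs_le]; constructor <;> simp only [ha] at h1 h2 h3 h4 ⊢ <;> linarith

/-- Lower bound for the mean number of steps before visiting `C`. -/
theorem MixedAt.le_sum_mean_survival (hm : MixedAt P w m d) (hw : InvariantWeights P w)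
    (hv : 0 ≤ v) (hv1 : ∑ x, v x = 1) (hq : 1 - mean v (survival P C m) ≤ q)
    (hs : HasSum (fun k => mean v (survival P C k)) T) (K : ℕ) :
    K * (1 - (K + 1) * mean w (C.indicator 1) - d - q) ≤ T := by
  have h1 : ∀ k ∈ Finset.range K,
      1 - (K + 1) * mean w (C.indicator 1) - d - q ≤ mean v (survival P C (m + k)) := by
    intro k hk
    have h2 := abs_le.1 (hm.abs_mean_survival_sub_le (C := C) hv hv1 k)
    have h3 := hw.one_sub_mean_survival_le C K
    have h4 := mean_survival_antitone (P := P) (C := C) hw.nonneg (Finset.mem_range.1 hk).le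
    simp only at h4
    linarith
  have h2 := Finset.sum_le_sum h1
  rw [Finset.sum_const, Finset.card_range, nsmul_eq_mul] at h2
  refine h2.trans ?_
  have h3 := hs.summable.sum_add_tsum_nat_add m
  have h0 : ∀ k, 0 ≤ mean v (survival P C k) := fun k => (mean_survival_mem_Icc hv hv1 k).1
  refine le_trans ?_ (sum_le_hasSum (Finset.range (m + K)) (fun k _ => h0 k) hs)
  rw [Finset.sum_range_add]
  exact le_add_of_nonneg_left (Finset.sum_nonneg fun k _ => h0 k)

end Operators

/-! ### Marginals of the jump chain -/

theorem killedOp_empty {S : Type} [Fintype S] {P : S → PMF S} : killedOp P ∅ = stepOp P := by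
  ext h x; simp [killedOp_apply]

section JumpChain

variable {S : Type} [MeasurableSpace S]

/-- The weights of the points under a measure. -/
def weights (ν : Measure S) (x : S) : ℝ := ν.real {x}

theorem weights_nonneg {ν : Measure S} : 0 ≤ weights ν := fun _ => measureReal_nonneg

variable [DiscreteMeasurableSpace S]

theorem measurableSet_avoid (C : Set S) (k : ℕ) :
    MeasurableSet {y : ℕ → S | ∀ i ≤ k, y i ∉ C} := by
  have : {y : ℕ → S | ∀ i ≤ k, y i ∉ C} = ⋂ i ∈ Set.Iic k, Function.eval i ⁻¹' Cᶜ := by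
    ext y; simp
  rw [this]
  exact .biInter (Set.to_countable _) fun i _ =>
    measurable_pi_apply i (MeasurableSet.of_discrete (s := Cᶜ))


/-- The law of the jump chain. -/
def jumpLaw (P : S → PMF S) (ν : Measure S) : Measure (ℕ → S) :=
  Kernel.trajMeasure (X := fun _ => S) ν (historyKernel P)

variable {P : S → PMF S} {ν : Measure S}

instance [IsProbabilityMeasure ν] : IsProbabilityMeasure (jumpLaw P ν) := by
  unfold jumpLaw; infer_instance

theorem integral_eq_mean [Fintype S] [IsFiniteMeasure ν] (h : S → ℝ) : ∫ x, h x ∂ν = mean (weights ν) h := by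
  rw [integral_fintype .of_finite]; rfl

theorem sum_weights [Fintype S] [IsProbabilityMeasure ν] : ∑ x, weights ν x = 1 := by
  have := integral_eq_mean (ν := ν) (fun _ => 1)
  simpa [mean_apply] using this.symm

theorem integral_stepKernel [Fintype S] (h : S → ℝ) (x : S) : ∫ y, h y ∂(stepKernel P x) = stepOp P h x := by
  rw [integral_eq_mean, mean_apply, stepOp_apply]
  refine Finset.sum_congr rfl fun y _ => ?_
  congr 1
  rw [weights, Measure.real]
  exact congrArg _ (PMF.toMeasure_apply_singleton _ _ (.of_discrete))

theorem jumpLaw_map_zero [IsProbabilityMeasure ν] :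
    (jumpLaw P ν).map (Function.eval 0) = ν := by
  have h1 : (Function.eval 0 : (ℕ → S) → S)
      = MeasurableEquiv.piUnique (fun _ : Finset.Iic 0 => S) ∘ Preorder.frestrictLe 0 := rfl
  rw [h1, ← Measure.map_map (MeasurableEquiv.measurable _) (by fun_prop), jumpLaw,
    Kernel.trajMeasure, Measure.map_comp _ _ (by fun_prop), Kernel.traj_map_frestrictLe,
    Kernel.partialTraj_self, Measure.id_comp, Measure.map_map (by fun_prop) (by fun_prop)]
  exact Measure.map_id

variable [Fintype S]

/-- The probability that the jump chain avoids `C` up to step `k`, weighted by a function of the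
final state. -/
theorem integral_avoid_mul [IsProbabilityMeasure ν] (C : Set S) (k : ℕ) (h : S → ℝ) :
    ∫ y, {y : ℕ → S | ∀ i ≤ k, y i ∉ C}.indicator (fun y => h (y k)) y ∂(jumpLaw P ν)
      = mean (weights ν) ((killedOp P C ^ k) (Cᶜ.indicator h)) := by
  induction k generalizing h with
  | zero =>
    rw [pow_zero, Module.End.one_apply, ← integral_eq_mean]
    conv_rhs => rw [← jumpLaw_map_zero (P := P) (ν := ν)]
    rw [integral_map (measurable_pi_apply 0).aemeasurable
      (Measurable.of_discrete.aestronglyMeasurable)]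
    refine integral_congr_ae (.of_forall fun y => ?_)
    by_cases hy : y 0 ∈ C
    · have : y ∉ {y : ℕ → S | ∀ i ≤ 0, y i ∉ C} := fun h => h 0 le_rfl hy
      simp only [Set.indicator_of_notMem this]
      simp [hy]
    · have : y ∈ {y : ℕ → S | ∀ i ≤ 0, y i ∉ C} := fun i hi => by rwa [Nat.le_zero.1 hi]
      simp only [Set.indicator_of_mem this]
      simp [hy]
  | succ k ih =>
    -- The last step is integrated out given the history, replacing `h` by `stepOp P h'`; this is
    -- why the induction runs over all `h`.
    rw [pow_succ, Module.End.mul_apply, killedOp_apply, ← ih]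
    set h' := Cᶜ.indicator h with hh'
    let A : Set (Finset.Iic k → S) := Set.univ.pi fun _ => Cᶜ
    have hA : MeasurableSet A := .univ_pi fun _ => .of_discrete
    let F : (Finset.Iic k → S) → ℝ := A.indicator fun _ => 1
    have hFm : Measurable F := measurable_const.indicator hA
    have hF1 : ∀ p, |F p| ≤ 1 := by
      intro p
      by_cases hp : p ∈ A <;> simp [F, hp]
    have hmemA : ∀ y : ℕ → S, Preorder.frestrictLe (π := fun _ => S) k y ∈ A
        ↔ ∀ i ≤ k, y i ∉ C := by
      intro y; simp [A, Set.mem_pi]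
    obtain ⟨c, hc⟩ : ∃ c, ∀ x, |h' x| ≤ c :=
      ⟨∑ x, |h' x|, fun x => Finset.single_le_sum (f := fun x => |h' x|)
        (fun _ _ => abs_nonneg _) (Finset.mem_univ x)⟩
    have hG : Measurable fun p : (Finset.Iic k → S) × S => F p.1 * h' p.2 :=
      (hFm.comp measurable_fst).mul ((Measurable.of_discrete (f := h')).comp measurable_snd)
    have hres : Measurable (Preorder.frestrictLe (π := fun _ : ℕ => S) k) := by fun_prop
    have hmap := Kernel.map_frestrictLe_trajMeasure_compProd_eq_map_trajMeasure
      (X := fun _ => S) (μ₀ := ν) (κ := historyKernel P) (a := k)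
    have hpair : Measurable fun y : ℕ → S =>
        (Preorder.frestrictLe (π := fun _ : ℕ => S) k y, y (k + 1)) :=
      hres.prodMk (measurable_pi_apply _)
    have hprob : IsProbabilityMeasure
        ((jumpLaw P ν).map (Preorder.frestrictLe (π := fun _ : ℕ => S) k)) :=
      Measure.isProbabilityMeasure_map hres.aemeasurable
    calc
      _ = ∫ y, F (Preorder.frestrictLe (π := fun _ => S) k y) * h' (y (k + 1))
            ∂(jumpLaw P ν) := by
          refine integral_congr_ae (.of_forall fun y => ?_)
          by_cases h1 : ∀ i ≤ k, y i ∉ C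
          · by_cases h2 : y (k + 1) ∈ C
            · have : y ∉ {y : ℕ → S | ∀ i ≤ k + 1, y i ∉ C} := fun h => h _ le_rfl h2
              simp only [Set.indicator_of_notMem this]
              simp [hh', h2]
            · have : y ∈ {y : ℕ → S | ∀ i ≤ k + 1, y i ∉ C} := fun i hi => by
                rcases Nat.le_succ_iff.1 hi with hi | rfl
                exacts [h1 i hi, h2]
              simp only [Set.indicator_of_mem this]
              simp only [F, Set.indicator_of_mem ((hmemA y).2 h1), one_mul, hh',
                Set.indicator_of_mem (show y (k + 1) ∈ Cᶜ from h2)]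
          · have : y ∉ {y : ℕ → S | ∀ i ≤ k + 1, y i ∉ C} := fun h =>
              h1 fun i hi => h i (hi.trans k.le_succ)
            simp only [Set.indicator_of_notMem this]
            simp only [F, Set.indicator_of_notMem (mt (hmemA y).1 h1), zero_mul]
      _ = ∫ p, F p.1 * h' p.2 ∂((jumpLaw P ν).map fun y : ℕ → S =>
            (Preorder.frestrictLe (π := fun _ : ℕ => S) k y, y (k + 1))) := by
          rw [integral_map hpair.aemeasurable hG.aestronglyMeasurable]
      _ = ∫ p, F p.1 * h' p.2 ∂((jumpLaw P ν).map
            (Preorder.frestrictLe (π := fun _ : ℕ => S) k) ⊗ₘ historyKernel P k) :=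
          congrArg (fun μ : Measure ((Finset.Iic k → S) × S) => ∫ p, F p.1 * h' p.2 ∂μ) hmap.symm
      _ = ∫ p, ∫ z, F p * h' z ∂(historyKernel P k p) ∂((jumpLaw P ν).map
            (Preorder.frestrictLe (π := fun _ : ℕ => S) k)) := by
          refine Measure.integral_compProd (Integrable.of_bound hG.aestronglyMeasurable c
            (.of_forall fun p => ?_))
          rw [Real.norm_eq_abs, abs_mul]
          exact (mul_le_of_le_one_left (abs_nonneg _) (hF1 _)).trans (hc _)
      _ = ∫ p, F p * stepOp P h' (p ⟨k, Finset.mem_Iic.2 le_rfl⟩) ∂((jumpLaw P ν).map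
            (Preorder.frestrictLe (π := fun _ : ℕ => S) k)) := by
          refine integral_congr_ae (.of_forall fun p => ?_)
          simp only [integral_const_mul]
          rw [← integral_stepKernel]
          rfl
      _ = _ := by
          have hm : Measurable fun p : Finset.Iic k → S =>
              F p * stepOp P h' (p ⟨k, Finset.mem_Iic.2 le_rfl⟩) :=
            hFm.mul ((Measurable.of_discrete (f := stepOp P h')).comp (measurable_pi_apply _))
          rw [integral_map hres.aemeasurable hm.aestronglyMeasurable]
          refine integral_congr_ae (.of_forall fun y => ?_)
          by_cases h1 : ∀ i ≤ k, y i ∉ C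
          · have : y ∈ {y : ℕ → S | ∀ i ≤ k, y i ∉ C} := h1
            simp only [Set.indicator_of_mem this]
            simp only [F, Set.indicator_of_mem ((hmemA y).2 h1), one_mul]
            rfl
          · have : y ∉ {y : ℕ → S | ∀ i ≤ k, y i ∉ C} := h1
            simp only [Set.indicator_of_notMem this]
            simp only [F, Set.indicator_of_notMem (mt (hmemA y).1 h1), zero_mul]

theorem jumpLaw_avoid [IsProbabilityMeasure ν] (C : Set S) (k : ℕ) :
    (jumpLaw P ν).real {y | ∀ i ≤ k, y i ∉ C} = mean (weights ν) (survival P C k) := by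
  rw [survival, ← integral_avoid_mul, ← integral_indicator_one (measurableSet_avoid C k)]
  rfl

theorem jumpLaw_mem [IsProbabilityMeasure ν] (Z : Set S) (k : ℕ) :
    (jumpLaw P ν).real {y | y k ∈ Z} = mean (weights ν) ((stepOp P ^ k) (Z.indicator 1)) := by
  have h1 := integral_avoid_mul (P := P) (ν := ν) ∅ k (Z.indicator 1)
  have hZ : MeasurableSet {y : ℕ → S | y k ∈ Z} :=
    measurable_pi_apply k (MeasurableSet.of_discrete (s := Z))
  rw [killedOp_empty, Set.compl_empty, Set.indicator_univ] at h1
  rw [← h1, ← integral_indicator_one hZ]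
  simp [Set.indicator]

theorem mean_weights_dirac (x : S) (h : S → ℝ) : mean (weights (Measure.dirac x)) h = h x := by
  rw [← integral_eq_mean, integral_dirac]

end JumpChain

/-! ### Holding times -/

section Holding

/-- On the open half-line the moments are literally Euler's integrals for `Γ`. -/
theorem expMeasure_one_eq : expMeasure 1 =
    (volume.restrict (Set.Ioi 0)).withDensity fun x => ENNReal.ofReal (Real.exp (-x)) := by
  have h : exponentialPDF 1 =
      (Set.Ici 0).indicator fun x => ENNReal.ofReal (Real.exp (-x)) := by
    funext x
    by_cases hx : 0 ≤ x
    · rw [exponentialPDF_of_nonneg hx, Set.indicator_of_mem (by exact hx)]; simp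
    · rw [exponentialPDF_of_neg (not_le.1 hx), Set.indicator_of_notMem (by exact hx)]
  rw [Measure.restrict_congr_set Ioi_ae_eq_Ici, ← withDensity_indicator measurableSet_Ici, ← h]
  rfl

instance : IsProbabilityMeasure (expMeasure 1) := isProbabilityMeasure_expMeasure one_pos

theorem integrable_pow_expMeasure (k : ℕ) : Integrable (fun x : ℝ => x ^ k) (expMeasure 1) := by
  rw [expMeasure_one_eq, integrable_withDensity_iff_integrable_smul' (by fun_prop)
    (.of_forall fun _ => ENNReal.ofReal_lt_top)]
  have h := Real.GammaIntegral_convergent (s := (k : ℝ) + 1) (by positivity)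
  refine (integrable_congr ?_).1 h
  refine .of_forall fun x => ?_
  simp [ENNReal.toReal_ofReal (Real.exp_pos _).le]

theorem integral_pow_expMeasure (k : ℕ) : ∫ x, x ^ k ∂(expMeasure 1) = (k ! : ℝ) := by
  rw [expMeasure_one_eq, integral_withDensity_eq_integral_toReal_smul (by fun_prop)
    (.of_forall fun _ => ENNReal.ofReal_lt_top), ← Real.Gamma_nat_eq_factorial,
    Real.Gamma_eq_integral (by positivity)]
  refine integral_congr_ae (.of_forall fun x => ?_)
  simp [ENNReal.toReal_ofReal (Real.exp_pos _).le]

theorem ae_pos_expMeasure : ∀ᵐ x ∂(expMeasure 1), 0 < x := by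
  rw [expMeasure_one_eq]
  exact (withDensity_absolutelyContinuous _ _).ae_le (ae_restrict_mem measurableSet_Ioi)

theorem lintegral_expMeasure : ∫⁻ x, ENNReal.ofReal x ∂(expMeasure 1) = 1 := by
  have h1 := integrable_pow_expMeasure 1
  have h2 := integral_pow_expMeasure 1
  simp only [pow_one] at h1 h2
  rw [← ofReal_integral_eq_lintegral_ofReal h1 (ae_pos_expMeasure.mono fun x hx => hx.le), h2]
  simp

/-- The law of the sequence of holding times. -/
def holdingLaw : Measure (ℕ → ℝ) := Measure.infinitePi fun _ : ℕ => expMeasure 1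

instance : IsProbabilityMeasure holdingLaw := by unfold holdingLaw; infer_instance

theorem measurePreserving_holding (i : ℕ) :
    MeasurePreserving (Function.eval i) holdingLaw (expMeasure 1) :=
  measurePreserving_eval_infinitePi _ i

theorem ae_holding_pos : ∀ᵐ ξ ∂holdingLaw, ∀ i, 0 < ξ i := by
  rw [ae_all_iff]
  intro i
  exact (measurePreserving_holding i).quasiMeasurePreserving.ae ae_pos_expMeasure

/-- The time of the `k`-th jump as a function of the holding times. -/
def arrival (k : ℕ) (ξ : ℕ → ℝ) : ℝ := ∑ i ∈ Finset.range k, ξ i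

theorem measurable_arrival (k : ℕ) : Measurable (arrival k) := by
  unfold arrival; fun_prop

theorem memLp_holding (i : ℕ) : MemLp (Function.eval i : (ℕ → ℝ) → ℝ) 2 holdingLaw := by
  have h : MemLp (id : ℝ → ℝ) 2 (expMeasure 1) := by
    rw [memLp_two_iff_integrable_sq (by fun_prop)]
    exact integrable_pow_expMeasure 2
  exact h.comp_measurePreserving (measurePreserving_holding i)

theorem integral_holding (i : ℕ) : ∫ ξ, ξ i ∂holdingLaw = 1 := by
  have h1 := integral_pow_expMeasure 1
  simp only [pow_one, Nat.factorial_one, Nat.cast_one] at h1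
  rw [← h1, ← (measurePreserving_holding i).map_eq, integral_map
    (measurable_pi_apply i).aemeasurable (by fun_prop)]

theorem variance_holding (i : ℕ) : variance (Function.eval i : (ℕ → ℝ) → ℝ) holdingLaw = 1 := by
  have h2 := integral_pow_expMeasure 2
  have h1 : ∫ ξ : ℕ → ℝ, (Function.eval i ^ 2 : (ℕ → ℝ) → ℝ) ξ ∂holdingLaw = 2 := by
    rw [← (measurePreserving_holding i).map_eq, integral_map
      (measurable_pi_apply i).aemeasurable (by fun_prop)] at h2
    simpa [Nat.factorial] using h2
  rw [variance_eq_sub (memLp_holding i), h1]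
  have := integral_holding i
  simp only [Function.eval] at this ⊢
  rw [this]; norm_num

/-- Chebyshev's inequality for the arrival times. -/
theorem holdingLaw_abs_arrival_sub_ge (k : ℕ) {c : ℝ} (hc : 0 < c) :
    holdingLaw.real {ξ | c ≤ |arrival k ξ - k|} ≤ k / c ^ 2 := by
  have harr : arrival k = ∑ i ∈ Finset.range k, (Function.eval i : (ℕ → ℝ) → ℝ) := by
    funext ξ; simp [arrival]
  have hmem : MemLp (arrival k) 2 holdingLaw := by
    rw [harr]; exact memLp_finsetSum' _ fun i _ => memLp_holding i
  have hmean : ∫ ξ, arrival k ξ ∂holdingLaw = k := by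
    simp only [arrival]
    rw [integral_finsetSum _ fun i _ => (memLp_holding i).integrable (by norm_num)]
    simp [integral_holding]
  have hvar : variance (arrival k) holdingLaw = k := by
    rw [harr, IndepFun.variance_sum (fun i _ => memLp_holding i)]
    · simp [variance_holding]
    · intro i _ j _ hij
      have h := iIndepFun_infinitePi (P := fun _ : ℕ => expMeasure 1) (X := fun _ x => x)
        (fun _ => measurable_id)
      exact h.indepFun hij
  have h := meas_ge_le_variance_div_sq hmem hc
  rw [hmean, hvar] at h
  rw [Measure.real]
  exact ENNReal.toReal_le_of_le_ofReal (by positivity) h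

theorem holdingLaw_lt_arrival (k : ℕ) {t : ℝ} (hk : k < t) :
    holdingLaw.real {ξ | t < arrival k ξ} ≤ k / (t - k) ^ 2 := by
  refine (measureReal_mono fun ξ (hξ : t < arrival k ξ) => ?_).trans
    (holdingLaw_abs_arrival_sub_ge k (sub_pos.2 hk))
  exact (sub_le_sub_right hξ.le _).trans (le_abs_self _)

theorem holdingLaw_arrival_le (k : ℕ) {t : ℝ} (hk : t < k) :
    holdingLaw.real {ξ | arrival k ξ ≤ t} ≤ k / (k - t) ^ 2 := by
  refine (measureReal_mono fun ξ (hξ : arrival k ξ ≤ t) => ?_).trans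
    (holdingLaw_abs_arrival_sub_ge k (sub_pos.2 hk))
  exact (sub_le_sub_left hξ _).trans ((neg_sub (arrival k ξ) k).symm.le.trans (neg_le_abs _))

/-- Chebyshev's inequality suffices to exclude explosion: the probability that `k + 1 + N` jumps
occur by time `N` is at most `(k + 1 + N) / (k + 1)^2`, which tends to zero. -/
theorem ae_arrival_unbounded : ∀ᵐ ξ ∂holdingLaw, ∀ t : ℝ, ∃ k, t < arrival k ξ := by
  have h1 : ∀ N : ℕ, ∀ᵐ ξ ∂holdingLaw, ∃ k, (N : ℝ) < arrival k ξ := by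
    intro N
    rw [ae_iff]
    simp only [not_exists, not_lt]
    rw [← measureReal_eq_zero_iff]
    refine le_antisymm ?_ measureReal_nonneg
    have h2 : Tendsto (fun k : ℕ => ((k + 1 + N : ℕ) : ℝ) / (k + 1) ^ 2) atTop (𝓝 0) := by
      have h3 : Tendsto (fun k : ℕ => ((k : ℝ) + 1)⁻¹ + N * (((k : ℝ) + 1)⁻¹) ^ 2) atTop
          (𝓝 (0 + N * 0 ^ 2)) := by
        have h4 : Tendsto (fun k : ℕ => ((k : ℝ) + 1)⁻¹) atTop (𝓝 0) :=
          (tendsto_natCast_atTop_atTop.atTop_add tendsto_const_nhds).inv_tendsto_atTop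
        exact h4.add ((h4.pow 2).const_mul _)
      simp only [ne_eq, OfNat.ofNat_ne_zero, not_false_eq_true, zero_pow, mul_zero,
        add_zero] at h3
      refine h3.congr fun k => ?_
      push_cast
      field_simp
    refine ge_of_tendsto' h2 fun k => ?_
    have h5 := holdingLaw_arrival_le (k + 1 + N) (t := N) (by
      push_cast; linarith [k.cast_nonneg (α := ℝ)])
    push_cast at h5 ⊢
    rw [add_sub_cancel_right] at h5
    exact (measureReal_mono fun ξ (hξ : ∀ k, arrival k ξ ≤ N) => hξ (k + 1 + N)).trans h5
  filter_upwards [ae_all_iff.2 h1] with ξ hξ t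
  obtain ⟨N, hN⟩ := exists_nat_ge t
  obtain ⟨k, hk⟩ := hξ N
  exact ⟨k, hN.trans_lt hk⟩

end Holding

/-! ### From the jump chain to the continuous-time chain -/

section Paths

variable {S : Type} {ω : Sample S} {C : Set S} {k : ℕ} {t : ℝ}

/-- The holding times are positive and the jump times are unbounded. -/
structure RegularClock (ξ : ℕ → ℝ) : Prop where
  pos : ∀ i, 0 < ξ i
  unbounded : ∀ t : ℝ, ∃ k, t < arrival k ξ

theorem RegularClock.strictMono {ξ : ℕ → ℝ} (h : RegularClock ξ) :
    StrictMono fun k => arrival k ξ := by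
  refine strictMono_nat_of_lt_succ fun k => ?_
  rw [arrival, arrival, Finset.sum_range_succ]
  exact lt_add_of_pos_right _ (h.pos k)

theorem RegularClock.arrival_nonneg {ξ : ℕ → ℝ} (h : RegularClock ξ) (k : ℕ) :
    0 ≤ arrival k ξ := Finset.sum_nonneg fun i _ => (h.pos i).le

theorem RegularClock.arrival_succ_pos {ξ : ℕ → ℝ} (h : RegularClock ξ) (k : ℕ) :
    0 < arrival (k + 1) ξ := (h.arrival_nonneg 0).trans_lt (h.strictMono k.succ_pos)

/-- A supremum in `ℕ` takes the default value `0` on unbounded sets. A regular clock excludes this,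
and `t ≥ 0` makes the set nonempty, so the supremum is attained. -/
theorem RegularClock.isGreatest_jumpCount (h : RegularClock ω.2) (ht : 0 ≤ t) :
    IsGreatest {k : ℕ | jumpTime ω k ≤ t} (jumpCount ω t) := by
  have hne : {k : ℕ | jumpTime ω k ≤ t}.Nonempty := ⟨0, by simpa [jumpTime] using ht⟩
  have hbdd : BddAbove {k : ℕ | jumpTime ω k ≤ t} := by
    obtain ⟨K, hK⟩ := h.unbounded t
    exact ⟨K, fun k (hk : arrival k ω.2 ≤ t) => (h.strictMono.lt_iff_lt.1 (hk.trans_lt hK)).le⟩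
  exact ⟨Nat.sSup_mem hne hbdd, fun k hk => le_csSup hbdd hk⟩

theorem RegularClock.jumpCount_arrival (h : RegularClock ω.2) (k : ℕ) :
    jumpCount ω (jumpTime ω k) = k := by
  have h1 := h.isGreatest_jumpCount (h.arrival_nonneg k)
  exact le_antisymm (h.strictMono.le_iff_le.1 h1.1) (h1.2 (show jumpTime ω k ≤ jumpTime ω k from le_rfl))

theorem RegularClock.le_jumpCount (h : RegularClock ω.2) (hk : jumpTime ω k ≤ t) :
    k ≤ jumpCount ω t :=
  (h.isGreatest_jumpCount ((h.arrival_nonneg k).trans hk)).2 hk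

theorem RegularClock.hittingTime_le (h : RegularClock ω.2) (hk : ω.1 k ∈ C) :
    hittingTime C ω ≤ ENNReal.ofReal (jumpTime ω k) := by
  refine iInf₂_le_of_le (jumpTime ω k).toNNReal ?_ le_rfl
  rw [Real.coe_toNNReal (jumpTime ω k) (h.arrival_nonneg k), state, h.jumpCount_arrival]
  exact hk

/-- The state after `k` jumps is kept until jump `k + 1`, whence the index shift. -/
theorem RegularClock.le_hittingTime (h : RegularClock ω.2) (hk : ∀ i ≤ k, ω.1 i ∉ C) :
    ENNReal.ofReal (jumpTime ω (k + 1)) ≤ hittingTime C ω := by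
  refine le_iInf₂ fun t ht => ?_
  have h1 := h.isGreatest_jumpCount t.2
  have h2 : k < jumpCount ω t := by
    by_contra hlt
    exact hk _ (not_lt.1 hlt) ht
  refine ENNReal.ofReal_le_of_le_toReal ?_
  exact (h.strictMono.monotone h2).trans h1.1

/-- The hitting time is the sum of the holding times before the jump chain enters `C`. -/
theorem RegularClock.hittingTime_eq_tsum (h : RegularClock ω.2) :
    hittingTime C ω = ∑' i, {y : ℕ → S | ∀ j ≤ i, y j ∉ C}.indicator 1 ω.1
      * ENNReal.ofReal (ω.2 i) := by
  have hsum : ∀ k, ∑ i ∈ Finset.range k, ENNReal.ofReal (ω.2 i)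
      = ENNReal.ofReal (jumpTime ω k) := fun k => by
    rw [jumpTime, ENNReal.ofReal_sum_of_nonneg fun i _ => (h.pos i).le]
  have hind : ∀ i, (∀ j ≤ i, ω.1 j ∉ C) →
      {y : ℕ → S | ∀ j ≤ i, y j ∉ C}.indicator (1 : (ℕ → S) → ℝ≥0∞) ω.1 = 1 := fun i hi =>
    Set.indicator_of_mem (s := {y : ℕ → S | ∀ j ≤ i, y j ∉ C}) hi _
  by_cases hC : ∃ k, ω.1 k ∈ C
  · classical
    have hκ := Nat.find_spec hC
    set κ := Nat.find hC with hκd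
    have hmin : ∀ i < κ, ω.1 i ∉ C := fun i hi => Nat.find_min hC hi
    have h1 : hittingTime C ω = ENNReal.ofReal (jumpTime ω κ) := by
      refine le_antisymm (h.hittingTime_le hκ) ?_
      rcases Nat.eq_zero_or_eq_succ_pred κ with h0 | h0
      · rw [h0]; simp [jumpTime]
      · rw [h0]
        exact h.le_hittingTime fun i hi => hmin i (by omega)
    rw [h1, tsum_eq_sum (s := Finset.range κ), ← hsum]
    · refine Finset.sum_congr rfl fun i hi => ?_
      rw [hind i fun j hj => hmin j (hj.trans_lt (Finset.mem_range.1 hi)), one_mul]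
    · intro i hi
      have : ω.1 ∉ {y : ℕ → S | ∀ j ≤ i, y j ∉ C} := fun hy =>
        hy κ (not_lt.1 fun hlt => hi (Finset.mem_range.2 hlt)) hκ
      rw [Set.indicator_of_notMem this, zero_mul]
  · push Not at hC
    have h1 : hittingTime C ω = ∞ := by
      refine ENNReal.eq_top_of_forall_nnreal_le fun t => ?_
      obtain ⟨k, hk⟩ := h.unbounded t
      refine le_trans ?_ (h.le_hittingTime (k := k) fun i _ => hC i)
      rw [← ENNReal.ofReal_coe_nnreal]
      exact ENNReal.ofReal_le_ofReal (hk.le.trans (h.strictMono.monotone k.le_succ))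
    rw [h1]
    refine (ENNReal.eq_top_of_forall_nnreal_le fun t => ?_).symm
    obtain ⟨k, hk⟩ := h.unbounded t
    refine le_trans ?_ (ENNReal.sum_le_tsum (Finset.range k))
    rw [Finset.sum_congr rfl fun i _ => by rw [hind i fun j _ => hC j, one_mul], hsum,
      ← ENNReal.ofReal_coe_nnreal]
    exact ENNReal.ofReal_le_ofReal hk.le

end Paths

section Link

variable {S : Type} [MeasurableSpace S] [DiscreteMeasurableSpace S]
  {P : S → PMF S} {ν : Measure S} {C : Set S} {t : ℝ}

/-- The supremum is rewritten as a countable supremum of measurable functions. On unbounded sets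
both sides have the default value `0`, so the identity holds everywhere. -/
theorem measurable_jumpCount (t : ℝ) :
    Measurable fun ξ : ℕ → ℝ => sSup {k : ℕ | arrival k ξ ≤ t} := by
  classical
  have h : (fun ξ : ℕ → ℝ => sSup {k : ℕ | arrival k ξ ≤ t})
      = fun ξ => ⨆ k, if arrival k ξ ≤ t then k else 0 := by
    funext ξ
    by_cases hb : BddAbove {k : ℕ | arrival k ξ ≤ t}
    · have hb' : BddAbove (Set.range fun k => if arrival k ξ ≤ t then k else 0) := by
        obtain ⟨B, hB⟩ := hb
        refine ⟨B, ?_⟩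
        rintro _ ⟨k, rfl⟩
        by_cases hk : arrival k ξ ≤ t
        · simp only [hk, if_true]; exact hB hk
        · simp [hk]
      refine le_antisymm ?_ (ciSup_le fun k => ?_)
      · rcases Set.eq_empty_or_nonempty {k : ℕ | arrival k ξ ≤ t} with he | hne
        · rw [he]; simp
        · refine csSup_le hne fun k hk => ?_
          have := le_ciSup hb' k
          rwa [if_pos (show arrival k ξ ≤ t from hk)] at this
      · by_cases hk : arrival k ξ ≤ t
        · rw [if_pos hk]; exact le_csSup hb hk
        · simp [hk]
    · have hb' : ¬ BddAbove (Set.range fun k => if arrival k ξ ≤ t then k else 0) := by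
        refine fun ⟨B, hB⟩ => hb ⟨B, fun k hk => ?_⟩
        have : (if arrival k ξ ≤ t then k else 0) ≤ B := hB ⟨k, rfl⟩
        rwa [if_pos (show arrival k ξ ≤ t from hk)] at this
      rw [iSup, Nat.sSup_of_not_bddAbove hb, Nat.sSup_of_not_bddAbove hb']
  rw [h]
  exact .iSup fun k => .ite (measurableSet_le (measurable_arrival k) measurable_const)
    measurable_const measurable_const

/-- The event is a countable union over the number of jumps, which depends on the clock alone. -/
theorem measurableSet_state_mem (t : ℝ) (Z : Set S) :
    MeasurableSet {ω : Sample S | state ω t ∈ Z} := by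
  set N : (ℕ → ℝ) → ℕ := fun ξ => sSup {k : ℕ | arrival k ξ ≤ t}
  have hNm : Measurable N := measurable_jumpCount t
  have h1 : {ω : Sample S | state ω t ∈ Z}
      = ⋃ k, {ω : Sample S | N ω.2 = k} ∩ {ω | ω.1 k ∈ Z} := by
    ext ω
    simp only [Set.mem_iUnion, Set.mem_inter_iff, Set.mem_ofPred_eq, exists_eq_left']
    rfl
  rw [h1]
  refine .iUnion fun k => .inter ?_ ?_
  · exact (hNm.comp measurable_snd) (measurableSet_singleton k)
  · exact ((measurable_pi_apply k).comp measurable_fst) (MeasurableSet.of_discrete (s := Z))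

theorem law_eq_prod (P : S → PMF S) (ν : Measure S) [IsProbabilityMeasure ν] :
    law P ν = (jumpLaw P ν).prod holdingLaw := rfl

theorem ae_regularClock : ∀ᵐ ω ∂(law P ν), RegularClock ω.2 := by
  have h : ∀ᵐ ξ ∂holdingLaw, RegularClock ξ := by
    filter_upwards [ae_holding_pos, ae_arrival_unbounded] with ξ h1 h2 using ⟨h1, h2⟩
  exact Measure.quasiMeasurePreserving_snd.ae h

theorem law_fst (A : Set (ℕ → S)) (hA : MeasurableSet A) :
    (law P ν).real {ω | ω.1 ∈ A} = (jumpLaw P ν).real A := by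
  have h : MeasurePreserving Prod.fst (law P ν) (jumpLaw P ν) := measurePreserving_fst
  exact h.measureReal_preimage hA.nullMeasurableSet

variable [IsProbabilityMeasure ν]

instance : IsProbabilityMeasure (law P ν) := by rw [law_eq_prod]; infer_instance

theorem law_snd (A : Set (ℕ → ℝ)) (hA : MeasurableSet A) :
    (law P ν).real {ω | ω.2 ∈ A} = holdingLaw.real A := by
  have h : MeasurePreserving Prod.snd (law P ν) holdingLaw := measurePreserving_snd
  exact h.measureReal_preimage hA.nullMeasurableSet

theorem law_lt_jumpTime (k : ℕ) :
    (law P ν).real {ω | t < jumpTime ω k} = holdingLaw.real {ξ | t < arrival k ξ} :=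
  law_snd _ (measurableSet_lt measurable_const (measurable_arrival k))

theorem law_jumpTime_le (k : ℕ) :
    (law P ν).real {ω | jumpTime ω k ≤ t} = holdingLaw.real {ξ | arrival k ξ ≤ t} :=
  law_snd _ (measurableSet_le (measurable_arrival k) measurable_const)

/-- A union bound on regular clocks. -/
theorem law_le_add {E A B : Set (Sample S)}
    (h : ∀ ω, RegularClock ω.2 → ω ∈ E → ω ∈ A ∨ ω ∈ B) :
    (law P ν).real E ≤ (law P ν).real A + (law P ν).real B := by
  refine le_trans ?_ (measureReal_union_le A B)
  refine ENNReal.toReal_mono (measure_ne_top _ _) (measure_mono_ae ?_)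
  filter_upwards [ae_regularClock (P := P) (ν := ν)] with ω hω hE using h ω hω hE

variable [Fintype S]

theorem law_avoid (k : ℕ) : (law P ν).real {ω | ∀ i ≤ k, ω.1 i ∉ C}
    = mean (weights ν) (survival P C k) := by
  rw [← jumpLaw_avoid, ← law_fst _ (measurableSet_avoid C k)]
  rfl

theorem law_not_avoid (k : ℕ) : (law P ν).real {ω | ∃ i ≤ k, ω.1 i ∈ C}
    = 1 - mean (weights ν) (survival P C k) := by
  have hm : MeasurableSet {ω : Sample S | ∀ i ≤ k, ω.1 i ∉ C} :=
    measurable_fst (measurableSet_avoid C k)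
  rw [← law_avoid, ← probReal_compl_eq_one_sub hm]
  congr 1
  ext ω
  simp

/-- If the first `k` steps avoid `C`, hitting it by time `t` requires that jump `k + 1` has already
occurred. This and the next three bounds compare time with the number of jumps, paying only for an
atypical clock. -/
theorem hitProb_le (k : ℕ) : hitProb P ν C t ≤
    (1 - mean (weights ν) (survival P C k)) + holdingLaw.real {ξ | arrival (k + 1) ξ ≤ t} := by
  rw [← law_not_avoid, ← law_jumpTime_le (P := P) (ν := ν)]
  refine law_le_add fun ω hω (hE : hittingTime C ω ≤ _) => ?_
  by_contra! h
  have h1 : ∀ i ≤ k, ω.1 i ∉ C := fun i hi hiC => h.1 ⟨i, hi, hiC⟩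
  have h2 := (hω.le_hittingTime h1).trans hE
  have h3 : t < jumpTime ω (k + 1) := not_le.1 h.2
  have h4 : 0 < jumpTime ω (k + 1) := hω.arrival_succ_pos k
  exact absurd h2 (not_le.2 ((ENNReal.ofReal_lt_ofReal_iff h4).2 h3))

theorem one_sub_survival_le (k : ℕ) : 1 - mean (weights ν) (survival P C k) ≤
    hitProb P ν C t + holdingLaw.real {ξ | t < arrival k ξ} := by
  rw [← law_not_avoid, ← law_lt_jumpTime (P := P) (ν := ν), hitProb]
  refine law_le_add fun ω hω ⟨i, hi, hiC⟩ => ?_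
  by_cases h : t < jumpTime ω k
  · exact .inr h
  · refine .inl ((hω.hittingTime_le hiC).trans (ENNReal.ofReal_le_ofReal ?_))
    exact (hω.strictMono.monotone hi).trans (not_lt.1 h)

theorem law_lt_hittingTime_le (k : ℕ) :
    (law P ν).real {ω | ENNReal.ofReal t < hittingTime C ω} ≤
      mean (weights ν) (survival P C k) + holdingLaw.real {ξ | t < arrival k ξ} := by
  rw [← law_avoid, ← law_lt_jumpTime (P := P) (ν := ν)]
  refine law_le_add fun ω hω (hE : _ < hittingTime C ω) => ?_
  by_cases h : t < jumpTime ω k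
  · exact .inr h
  · refine .inl fun i hi hiC => absurd hE (not_lt.2 ((hω.hittingTime_le hiC).trans
      (ENNReal.ofReal_le_ofReal ?_)))
    exact (hω.strictMono.monotone hi).trans (not_lt.1 h)

theorem survival_le_law_lt_hittingTime (k : ℕ) :
    mean (weights ν) (survival P C k) ≤
      (law P ν).real {ω | ENNReal.ofReal t < hittingTime C ω}
        + holdingLaw.real {ξ | arrival (k + 1) ξ ≤ t} := by
  rw [← law_avoid, ← law_jumpTime_le (P := P) (ν := ν)]
  refine law_le_add fun ω hω (hE : ∀ i ≤ k, ω.1 i ∉ C) => ?_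
  by_cases h : jumpTime ω (k + 1) ≤ t
  · exact .inr h
  · refine .inl (lt_of_lt_of_le ?_ (hω.le_hittingTime hE))
    have h4 : 0 < jumpTime ω (k + 1) := hω.arrival_succ_pos k
    exact (ENNReal.ofReal_lt_ofReal_iff h4).2 (not_le.1 h)

/-- The mean hitting time is the mean number of jumps before entering `C`. -/
theorem meanHittingTime_eq_tsum : meanHittingTime P ν C
    = ∑' k, ENNReal.ofReal (mean (weights ν) (survival P C k)) := by
  have hm : ∀ k, Measurable ({y : ℕ → S | ∀ j ≤ k, y j ∉ C}.indicator (1 : (ℕ → S) → ℝ≥0∞)) :=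
    fun k => measurable_one.indicator (measurableSet_avoid C k)
  have hm' : ∀ k : ℕ, Measurable fun ξ : ℕ → ℝ => ENNReal.ofReal (ξ k) := fun k =>
    (measurable_pi_apply k).ennreal_ofReal
  have hprod : ∀ k, Measurable fun ω : Sample S =>
      {y : ℕ → S | ∀ j ≤ k, y j ∉ C}.indicator (1 : (ℕ → S) → ℝ≥0∞) ω.1
        * ENNReal.ofReal (ω.2 k) := fun k =>
    ((hm k).comp measurable_fst).mul ((hm' k).comp measurable_snd)
  rw [meanHittingTime, lintegral_congr_ae
    ((ae_regularClock (P := P) (ν := ν)).mono fun ω hω => hω.hittingTime_eq_tsum),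
    lintegral_tsum fun k => (hprod k).aemeasurable]
  refine tsum_congr fun k => ?_
  -- Avoidance up to step `k` concerns only the jump chain, so it is independent of the holding time
  -- `k`, whose mean is one.
  rw [law_eq_prod, lintegral_prod_mul (hm k).aemeasurable (hm' k).aemeasurable,
    lintegral_indicator_one (measurableSet_avoid C k), ← jumpLaw_avoid, Measure.real,
    ENNReal.ofReal_toReal (measure_ne_top _ _)]
  have h := (measurePreserving_holding k).lintegral_comp ENNReal.measurable_ofReal
  simp only [Function.eval] at h
  rw [h, lintegral_expMeasure, mul_one]

/-- The law of the continuous-time chain at time `t` is close to the invariant law if the jump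
chain has mixed after `m` steps and `m` jumps are likely to occur before `t`. -/
theorem MixedAt.abs_law_state_sub_le {w : S → ℝ} {m : ℕ} {d : ℝ} (hm : MixedAt P w m d)
    (hw : InvariantWeights P w) (t : ℝ) (Z : Set S) :
    |(law P ν).real {ω | state ω t ∈ Z} - mean w (Z.indicator 1)|
      ≤ d + holdingLaw.real {ξ | t < arrival m ξ} := by
  set N : (ℕ → ℝ) → ℕ := fun ξ => sSup {k : ℕ | arrival k ξ ≤ t} with hN
  have hNm : Measurable N := measurable_jumpCount t
  set c := mean w (Z.indicator 1) with hc
  have hZ : Z.indicator (1 : S → ℝ) ∈ Set.Icc (0 : S → ℝ) 1 :=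
    ⟨Set.indicator_nonneg fun _ _ => zero_le_one, indicator_one_le Z⟩
  let ψ : ℕ → ℝ := fun k => mean (weights ν) ((stepOp P ^ k) (Z.indicator 1))
  have hψ : ∀ k, ψ k ∈ Set.Icc (0 : ℝ) 1 := fun k =>
    ⟨mean_nonneg weights_nonneg (stepOp_pow_mem_Icc P k hZ).1,
      mean_le_of_le weights_nonneg sum_weights (stepOp_pow_mem_Icc P k hZ).2⟩
  have hc01 : c ∈ Set.Icc (0 : ℝ) 1 :=
    ⟨mean_nonneg hw.nonneg hZ.1, mean_le_of_le hw.nonneg hw.sum_eq_one hZ.2⟩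
  have hψd : ∀ k, m ≤ k → |ψ k - c| ≤ d := by
    intro k hk
    have h1 : ∀ x, |(stepOp P ^ k) (Z.indicator 1) x - c| ≤ d := (hm.mono hw hk) _ hZ
    have h2 := mean_le_of_le (weights_nonneg (ν := ν)) sum_weights
      fun x => sub_le_iff_le_add.1 (abs_le.1 (h1 x)).2
    have h3 := mean_mono (weights_nonneg (ν := ν)) (show (fun _ => c - d) ≤
      (stepOp P ^ k) (Z.indicator 1) from fun x => by linarith [(abs_le.1 (h1 x)).1])
    rw [mean_const sum_weights] at h3
    rw [abs_le]; constructor <;> simp only [ψ] <;> linarith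
  have hmeas := measurableSet_state_mem (S := S) t Z
  -- Given the clock, the number of jumps `N` is fixed and the state is that of the jump chain at
  -- step `N`. Mixing applies as soon as `N ≥ m`.
  have hlaw : (law P ν).real {ω | state ω t ∈ Z} = ∫ ξ, ψ (N ξ) ∂holdingLaw := by
    have hint : (fun ξ => (jumpLaw P ν).real {y | y (N ξ) ∈ Z}) = fun ξ => ψ (N ξ) := by
      funext ξ; exact jumpLaw_mem Z (N ξ)
    rw [← hint, Measure.real, law_eq_prod, Measure.prod_apply_symm hmeas,
      ← integral_toReal]
    · rfl
    · exact (measurable_measure_prodMk_right hmeas).aemeasurable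
    · exact .of_forall fun ξ => measure_lt_top _ _
  have hψN : Integrable (fun ξ => ψ (N ξ)) holdingLaw :=
    .of_bound ((Measurable.of_discrete (f := ψ)).comp hNm).aestronglyMeasurable 1
      (.of_forall fun ξ => by
        rw [Real.norm_eq_abs, abs_of_nonneg (hψ _).1]; exact (hψ _).2)
  have hB : MeasurableSet {ξ | t < arrival m ξ} :=
    measurableSet_lt measurable_const (measurable_arrival m)
  have hd : 0 ≤ d := by
    obtain ⟨x⟩ : Nonempty S := by
      by_contra hS
      rw [not_nonempty_iff] at hS
      have := hw.sum_eq_one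
      simp at this
    exact (abs_nonneg _).trans (hm 0 ⟨le_rfl, fun _ => zero_le_one⟩ x)
  have hg : ∀ᵐ ξ ∂holdingLaw, RegularClock ξ := by
    filter_upwards [ae_holding_pos, ae_arrival_unbounded] with ξ h1 h2 using ⟨h1, h2⟩
  have hsub : (law P ν).real {ω | state ω t ∈ Z} - c = ∫ ξ, (ψ (N ξ) - c) ∂holdingLaw := by
    rw [hlaw, integral_sub hψN (integrable_const c)]; simp
  rw [hsub]
  refine (abs_integral_le_integral_abs).trans ?_
  have hle : ∫ ξ, |ψ (N ξ) - c| ∂holdingLaw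
      ≤ ∫ ξ, (d + {ξ | t < arrival m ξ}.indicator 1 ξ) ∂holdingLaw := by
    refine integral_mono_ae (hψN.sub (integrable_const c)).abs
      ((integrable_const d).add ((integrable_const 1).indicator hB)) ?_
    filter_upwards [hg] with ξ hξ
    by_cases h : t < arrival m ξ
    · have : ξ ∈ {ξ | t < arrival m ξ} := h
      simp only [Set.indicator_of_mem this, Pi.one_apply]
      have h1 := hψ (N ξ)
      have : |ψ (N ξ) - c| ≤ 1 := by
        rw [abs_le]; constructor <;> linarith [h1.1, h1.2, hc01.1, hc01.2]
      linarith
    · have : ξ ∉ {ξ | t < arrival m ξ} := h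
      simp only [Set.indicator_of_notMem this, add_zero]
      obtain ⟨x⟩ : Nonempty S := by
        by_contra hS
        rw [not_nonempty_iff] at hS
        have := hw.sum_eq_one
        simp at this
      exact hψd _ (RegularClock.le_jumpCount (ω := ((fun _ => x), ξ)) hξ (not_lt.1 h))
  refine hle.trans_eq ?_
  have hone : Integrable ({ξ | t < arrival m ξ}.indicator (1 : (ℕ → ℝ) → ℝ)) holdingLaw :=
    (integrable_const (1 : ℝ)).indicator hB
  rw [integral_add (integrable_const d) hone,
    integral_indicator_one hB]
  simp

/-- The total variation distance between the laws at time `t` from two starting points. -/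
theorem MixedAt.evolvedTV_le {w : S → ℝ} {m : ℕ} {d : ℝ} (hm : MixedAt P w m d)
    (hw : InvariantWeights P w) (t : ℝ) (x x' : S) :
    evolvedTV P t x x' ≤ 2 * (d + holdingLaw.real {ξ | t < arrival m ξ}) := by
  classical
  set ε := d + holdingLaw.real {ξ | t < arrival m ξ}
  have hsum : ∀ (z : S) (Z : Finset S), ∑ y ∈ Z, (lawAt P z).real {ω | state ω t = y}
      = (lawAt P z).real {ω | state ω t ∈ (Z : Set S)} := by
    intro z Z
    rw [lawAt, ← measureReal_biUnion_finset]
    · congr 1; ext ω; simp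
    · intro y _ y' _ hy
      exact Set.disjoint_left.2 fun ω (h : _ = y) (h' : _ = y') => hy (h.symm.trans h')
    · exact fun y _ => measurableSet_state_mem t {y}
  have hdiff : ∀ (z z' : S) (Z : Finset S), ∑ y ∈ Z,
      ((lawAt P z).real {ω | state ω t = y} - (lawAt P z').real {ω | state ω t = y})
        ≤ 2 * ε := by
    intro z z' Z
    rw [Finset.sum_sub_distrib, hsum, hsum]
    have h1 := abs_le.1 (hm.abs_law_state_sub_le (ν := Measure.dirac z) hw t Z)
    have h2 := abs_le.1 (hm.abs_law_state_sub_le (ν := Measure.dirac z') hw t Z)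
    simp only [lawAt]
    linarith [h1.2, h2.1]
  -- The sum is split by the sign of the difference. Each part is at most `2 * ε`, and the factor `1
  -- / 2` in the distance leaves `2 * ε`.
  rw [evolvedTV, ← Finset.sum_filter_add_sum_filter_not Finset.univ fun y =>
    (lawAt P x').real {ω | state ω t = y} ≤ (lawAt P x).real {ω | state ω t = y}]
  have h1 := hdiff x x' (Finset.univ.filter fun y =>
    (lawAt P x').real {ω | state ω t = y} ≤ (lawAt P x).real {ω | state ω t = y})
  have h2 := hdiff x' x (Finset.univ.filter fun y =>
    ¬ (lawAt P x').real {ω | state ω t = y} ≤ (lawAt P x).real {ω | state ω t = y})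
  rw [Finset.sum_congr rfl fun y hy => (abs_of_nonneg (sub_nonneg.2
    (Finset.mem_filter.1 hy).2)).symm] at h1
  rw [Finset.sum_congr rfl fun y hy => ((abs_of_nonpos (sub_nonpos.2
    (not_le.1 (Finset.mem_filter.1 hy).2).le)).trans (neg_sub _ _)).symm] at h2
  linarith

end Link

/-! ### Invariant weights of a stationary chain and of its reversal -/

section Stationary

variable {S : Type} [Fintype S]

theorem invariantWeights_of_sum_eq {P : S → PMF S} {w : S → ℝ} (h0 : 0 ≤ w)
    (h1 : ∑ x, w x = 1) (h : ∀ y, ∑ x, w x * (P x y).toReal = w y) : InvariantWeights P w := by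
  refine ⟨h0, h1, fun f => ?_⟩
  simp_rw [mean_apply, stepOp_apply, Finset.mul_sum]
  rw [Finset.sum_comm]
  refine Finset.sum_congr rfl fun y _ => ?_
  rw [← h y, Finset.sum_mul]
  exact Finset.sum_congr rfl fun x _ => (mul_assoc _ _ _).symm

theorem StationaryChain.invariantWeights (M : StationaryChain S) :
    InvariantWeights M.P fun x => (M.π x).toReal := by
  refine invariantWeights_of_sum_eq (fun _ => ENNReal.toReal_nonneg) (sum_toReal_eq_one _)
    fun y => ?_
  have h : M.π y = ∑ x, M.π x * M.P x y := by
    conv_lhs => rw [← M.invariant]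
    rw [PMF.bind_apply, tsum_fintype]
  rw [h, ENNReal.toReal_sum fun x _ =>
    ENNReal.mul_ne_top (M.π.apply_ne_top x) ((M.P x).apply_ne_top y)]
  simp [ENNReal.toReal_mul]

/-- The basin also involves the reversed chain, for which invariance is enough. It follows from
`π(x) P*(x,y) = π(y) P(y,x)`, summed over `x`. -/
theorem StationaryChain.invariantWeights_reversed (M : StationaryChain S) :
    InvariantWeights M.reversed fun x => (M.π x).toReal := by
  refine invariantWeights_of_sum_eq (fun _ => ENNReal.toReal_nonneg) (sum_toReal_eq_one _)
    fun y => ?_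
  have h : ∀ x, (M.π x).toReal * (M.reversed x y).toReal
      = (M.π y).toReal * (M.P y x).toReal := by
    intro x
    change _ * (M.π y * M.P y x / M.π x).toReal = _
    have : (M.π x).toReal ≠ 0 := ENNReal.toReal_ne_zero.2 ⟨M.pos x, M.π.apply_ne_top x⟩
    rw [ENNReal.toReal_div, ENNReal.toReal_mul]
    field_simp
  simp_rw [h, ← Finset.mul_sum, sum_toReal_eq_one, mul_one]

end Stationary

/-! ### Mixing of the top-in-at-random shuffle -/

section Mixing

variable {n : ℕ}

theorem stepOp_tiarStep [NeZero n] (h : Deck n → ℝ) (x : Deck n) :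
    stepOp (tiarStep n) h x = (n : ℝ)⁻¹ * ∑ k : Fin n, h (x * k.cycleRange) := by
  have hne : Nonempty (Fin n) := ⟨0⟩
  rw [← integral_stepKernel]
  have h1 : stepKernel (tiarStep n) x
      = (PMF.uniformOfFintype (Fin n)).toMeasure.map (shuffle x) := by
    rw [PMF.toMeasure_map (hf := .of_discrete)]
    change (tiarStep n x).toMeasure = _
    rw [tiarStep, dif_pos hne]
  rw [h1, integral_map (Measurable.of_discrete).aemeasurable
    (Measurable.of_discrete).aestronglyMeasurable, PMF.integral_eq_sum, Finset.mul_sum]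
  refine Finset.sum_congr rfl fun k _ => ?_
  simp [shuffle]

/-- The operator of the random-to-top shuffle acting on the positions of the cards. -/
def toTopOp (n : ℕ) : Module.End ℝ (Deck n → ℝ) where
  toFun h p := (n : ℝ)⁻¹ * ∑ k : Fin n, h (k.cycleRange * p)
  map_add' h h' := by
    funext p; simp [Finset.sum_add_distrib, mul_add]
  map_smul' c h := by
    funext p; simp [← Finset.mul_sum, mul_left_comm]

theorem toTopOp_apply (h : Deck n → ℝ) (p : Deck n) :
    toTopOp n h p = (n : ℝ)⁻¹ * ∑ k : Fin n, h (k.cycleRange * p) := rfl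

/-- One operator multiplies by cycles on the right, the other on the left. -/
theorem commute_stepOp_toTopOp [NeZero n] : Commute (stepOp (tiarStep n)) (toTopOp n) := by
  refine LinearMap.ext fun h => funext fun x => ?_
  simp only [Module.End.mul_apply, stepOp_tiarStep, toTopOp_apply, Finset.mul_sum]
  rw [Finset.sum_comm]
  simp [mul_assoc]

/-- Started from the ordered deck, top-in-at-random and random-to-top have the same law. -/
theorem stepOp_pow_one_eq_toTopOp_pow [NeZero n] (m : ℕ) (h : Deck n → ℝ) :
    (stepOp (tiarStep n) ^ m) h 1 = (toTopOp n ^ m) h 1 := by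
  induction m generalizing h with
  | zero => simp
  | succ m ih =>
    have h1 : ∀ g : Deck n → ℝ, stepOp (tiarStep n) g 1 = toTopOp n g 1 := fun g => by
      simp [stepOp_tiarStep, toTopOp_apply]
    -- The two operators agree at the identity. The outermost step is exchanged there for a
    -- random-to-top step, which is then commuted past the others.
    rw [pow_succ', Module.End.mul_apply, h1, ← Module.End.mul_apply,
      ← (commute_stepOp_toTopOp.pow_left m).eq, Module.End.mul_apply, ih, ← Module.End.mul_apply,
      ← pow_succ]

/-- The shuffle is a right random walk on the group, so the walk from `x` is `x` times the walk from
the identity. -/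
theorem stepOp_pow_apply [NeZero n] (m : ℕ) (h : Deck n → ℝ) (x : Deck n) :
    (stepOp (tiarStep n) ^ m) h x = (stepOp (tiarStep n) ^ m) (fun y => h (x * y)) 1 := by
  suffices ∀ z, (stepOp (tiarStep n) ^ m) h (x * z)
      = (stepOp (tiarStep n) ^ m) (fun y => h (x * y)) z by simpa using this 1
  induction m with
  | zero => simp
  | succ m ih =>
    intro z
    simp only [pow_succ', Module.End.mul_apply, stepOp_tiarStep, mul_assoc, ih]

/-- The cards of `W` occupy the same positions in `p` and `q`, above all other cards
(`p` and `q` send cards to positions). -/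
def AgreeOnTop (W : Finset (Fin n)) (p q : Deck n) : Prop :=
  (∀ c ∈ W, p c = q c) ∧ ∀ c ∈ W, ∀ b ∉ W, p c < p b ∧ q c < q b

theorem cycleRange_val (k i : Fin n) : (k.cycleRange i : ℕ) =
    if (i : ℕ) < k then (i : ℕ) + 1 else if (i : ℕ) = k then 0 else i := by
  have : NeZero n := ⟨fun h => (h ▸ k).elim0⟩
  split_ifs with h1 h2
  · exact Fin.coe_cycleRange_of_lt h1
  · rw [Fin.cycleRange_of_eq (Fin.ext h2)]; simp
  · rw [Fin.cycleRange_of_gt (Fin.lt_def.2 (by omega))]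

/-- Card `a` goes to the top in both decks and the other cards keep their relative order. If `a ∈
W`, it was at the same position in both. If `a ∉ W`, every card of `W` lay above it and moves down
by one in both decks. -/
theorem AgreeOnTop.insert {W : Finset (Fin n)} {p q : Deck n} (h : AgreeOnTop W p q)
    (a : Fin n) : AgreeOnTop (insert a W) ((p a).cycleRange * p) ((q a).cycleRange * q) := by
  obtain ⟨h1, h2⟩ := h
  have hp : ∀ b, b ≠ a → (p b : ℕ) ≠ p a := fun b hb he => hb (p.injective (Fin.ext he))
  have hq : ∀ b, b ≠ a → (q b : ℕ) ≠ q a := fun b hb he => hb (q.injective (Fin.ext he))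
  simp only [Fin.ext_iff, Fin.lt_def] at h1 h2
  constructor
  · intro c hc
    rw [Fin.ext_iff]
    simp only [Equiv.Perm.mul_apply, cycleRange_val]
    by_cases hca : c = a
    · subst hca; simp
    · have hcW : c ∈ W := (Finset.mem_insert.1 hc).resolve_left hca
      have e1 := h1 c hcW
      have e2 := hp c hca
      by_cases haW : a ∈ W
      · rw [e1, h1 a haW]
      · have e3 := h2 c hcW a haW
        rw [if_pos e3.1, if_pos e3.2, e1]
  · intro c hc b hb
    have hba : b ≠ a := fun he => hb (he ▸ Finset.mem_insert_self a W)
    have hbW : b ∉ W := fun he => hb (Finset.mem_insert_of_mem he)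
    have e2 := hp b hba
    have e3 := hq b hba
    simp only [Fin.lt_def, Equiv.Perm.mul_apply, cycleRange_val]
    by_cases hca : c = a
    · subst hca
      constructor <;> split_ifs <;> omega
    · have hcW : c ∈ W := (Finset.mem_insert.1 hc).resolve_left hca
      have e1 := h2 c hcW b hbW
      have e4 := hp c hca
      have e5 := hq c hca
      by_cases haW : a ∈ W
      · have e6 := h2 a haW b hbW
        constructor <;> split_ifs <;> omega
      · have e6 := h2 c hcW a haW
        constructor <;> split_ifs <;> omega

/-- Choosing a uniform card instead of a uniform position lets two decks be coupled by moving the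
same card. -/
theorem toTopOp_apply_card [NeZero n] (h : Deck n → ℝ) (p : Deck n) :
    toTopOp n h p = (n : ℝ)⁻¹ * ∑ a : Fin n, h ((p a).cycleRange * p) := by
  rw [toTopOp_apply, ← Equiv.sum_comp p]

/-- The coupling of two random-to-top shuffles that move the same card. -/
theorem AgreeOnTop.toTopOp_pow_sub_le [NeZero n] {h : Deck n → ℝ}
    (hh : h ∈ Set.Icc (0 : Deck n → ℝ) 1) (m : ℕ) {W : Finset (Fin n)} {p q : Deck n}
    (hW : AgreeOnTop W p q) :
    (toTopOp n ^ m) h p - (toTopOp n ^ m) h q ≤ (n - W.card : ℝ) * (1 - (n : ℝ)⁻¹) ^ m := by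
  have hn : (0 : ℝ) < n := by exact_mod_cast NeZero.pos n
  induction m generalizing W p q with
  | zero =>
    simp only [pow_zero, Module.End.one_apply, mul_one]
    -- Either the decks coincide, or at least one card is missing from `W` and the bound is at least
    -- one.
    by_cases hu : W = Finset.univ
    · have : p = q := Equiv.ext fun c => hW.1 c (hu ▸ Finset.mem_univ c)
      rw [this, hu]; simp
    · have h1 : W.card < n := by
        obtain ⟨a, ha⟩ := not_forall.1 (mt Finset.eq_univ_iff_forall.2 hu)
        simpa using Finset.card_lt_univ_of_notMem ha
      have h2 : (W.card : ℝ) + 1 ≤ n := by exact_mod_cast h1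
      have h3 : h p ≤ 1 := hh.2 p
      have h4 : 0 ≤ h q := hh.1 q
      linarith
  | succ m ih =>
    rw [pow_succ', Module.End.mul_apply, toTopOp_apply_card, toTopOp_apply_card, ← mul_sub,
      ← Finset.sum_sub_distrib]
    have h1 : ∑ a : Fin n, ((toTopOp n ^ m) h ((p a).cycleRange * p)
        - (toTopOp n ^ m) h ((q a).cycleRange * q))
        ≤ ∑ a : Fin n, ((n - W.card : ℝ) - if a ∈ W then 0 else 1) * (1 - (n : ℝ)⁻¹) ^ m := by
      refine Finset.sum_le_sum fun a _ => (ih (hW.insert a)).trans_eq ?_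
      congr 1
      by_cases ha : a ∈ W
      · simp [ha]
      · rw [Finset.card_insert_of_notMem ha, if_neg ha]; push_cast; ring
    -- A fraction `(n - |W|) / n` of the choices adds a card to `W`, so the mean number of missing
    -- cards is multiplied by `1 - 1/n`.
    have h2 : ∑ a : Fin n, (if a ∈ W then (0 : ℝ) else 1) = n - W.card := by
      have : ∀ a : Fin n, (if a ∈ W then (0 : ℝ) else 1) = 1 - if a ∈ W then 1 else 0 :=
        fun a => by split_ifs <;> simp
      simp [this, Finset.sum_sub_distrib]
    rw [← Finset.sum_mul, Finset.sum_sub_distrib (f := fun _ => (n - W.card : ℝ)), h2,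
      Finset.sum_const, Finset.card_univ,
      Fintype.card_fin, nsmul_eq_mul] at h1
    refine (mul_le_mul_of_nonneg_left h1 (inv_nonneg.2 hn.le)).trans_eq ?_
    rw [pow_succ]
    field_simp

/-- The precision to which the top-in-at-random shuffle has mixed after `m` steps. -/
theorem mixedAt_tiarStep [NeZero n] (m : ℕ) :
    MixedAt (tiarStep n) (fun x => ((tiar n).π x).toReal) m (n * (1 - (n : ℝ)⁻¹) ^ m) := by
  have hinv : InvariantWeights (tiarStep n) (fun x => ((tiar n).π x).toReal) :=
    (tiar n).invariantWeights
  have hcard : (0 : ℝ) < Fintype.card (Deck n) := by exact_mod_cast Fintype.card_pos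
  have hmean : ∀ h, mean (fun x => ((tiar n).π x).toReal) h
      = (Fintype.card (Deck n) : ℝ)⁻¹ * ∑ x, h x := by
    intro h
    rw [mean_apply, Finset.mul_sum]
    refine Finset.sum_congr rfl fun x _ => ?_
    simp [tiar]
  have htop : ∀ h : Deck n → ℝ, ∑ p, toTopOp n h p = ∑ p, h p := by
    intro h
    have hn : (n : ℝ) ≠ 0 := by exact_mod_cast NeZero.ne n
    simp only [toTopOp_apply, ← Finset.mul_sum]
    rw [Finset.sum_comm]
    have : ∀ k : Fin n, ∑ p : Deck n, h (k.cycleRange * p) = ∑ p, h p := fun k =>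
      Equiv.sum_comp (Equiv.mulLeft k.cycleRange) h
    simp [this, hn]
  have htop' : ∀ (h : Deck n → ℝ), ∑ p, (toTopOp n ^ m) h p = ∑ p, h p := by
    intro h
    induction m with
    | zero => simp
    | succ m ih => rw [pow_succ', Module.End.mul_apply, htop, ih]
  intro h hh x
  rw [stepOp_pow_apply, stepOp_pow_one_eq_toTopOp_pow]
  set g : Deck n → ℝ := fun y => h (x * y) with hg
  have hgI : g ∈ Set.Icc (0 : Deck n → ℝ) 1 := ⟨fun y => hh.1 (x * y), fun y => hh.2 (x * y)⟩
  set ε := (n : ℝ) * (1 - (n : ℝ)⁻¹) ^ m with hε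
  have hpq : ∀ p q : Deck n, (toTopOp n ^ m) g p - (toTopOp n ^ m) g q ≤ ε := by
    intro p q
    have hA : AgreeOnTop ∅ p q := ⟨by simp, by simp⟩
    simpa using hA.toTopOp_pow_sub_le hgI m
  -- The uniform mean is the average over all starting decks `p`; closeness for every pair of
  -- starting decks thus gives closeness to the mean.
  have hm : mean (fun x => ((tiar n).π x).toReal) h
      = (Fintype.card (Deck n) : ℝ)⁻¹ * ∑ p, (toTopOp n ^ m) g p := by
    rw [htop', hmean]
    congr 1
    exact (Equiv.sum_comp (Equiv.mulLeft x) h).symm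
  have h1 : ∑ p : Deck n, (toTopOp n ^ m) g p
      ≤ Fintype.card (Deck n) * ((toTopOp n ^ m) g 1 + ε) := by
    have := Finset.sum_le_sum fun (p : Deck n) (_ : p ∈ Finset.univ) =>
      sub_le_iff_le_add'.1 (hpq p 1)
    rwa [Finset.sum_const, nsmul_eq_mul] at this
  have h2 : Fintype.card (Deck n) * ((toTopOp n ^ m) g 1 - ε)
      ≤ ∑ p : Deck n, (toTopOp n ^ m) g p := by
    have := Finset.sum_le_sum fun (p : Deck n) (_ : p ∈ Finset.univ) =>
      sub_le_comm.1 (hpq 1 p)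
    rwa [Finset.sum_const, nsmul_eq_mul] at this
  have h3 : mean (fun x => ((tiar n).π x).toReal) h ≤ (toTopOp n ^ m) g 1 + ε := by
    rw [hm, inv_mul_le_iff₀ hcard]; exact h1
  have h4 : (toTopOp n ^ m) g 1 - ε ≤ mean (fun x => ((tiar n).π x).toReal) h := by
    rw [hm, le_inv_mul_iff₀ hcard]; exact h2
  rw [abs_le]; constructor <;> linarith

end Mixing

/-! ### Asymptotic exponentiality of the hitting time of the ordered deck -/

/-- For `k ≤ t/2`, Chebyshev's bound `k / (t - k)^2` is at most its value `2/t` at `k = t/2`. -/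
theorem holdingLaw_lt_arrival_le_two_div {k : ℕ} {t : ℝ} (ht : 0 < t) (hk : 2 * k ≤ t) :
    holdingLaw.real {ξ | t < arrival k ξ} ≤ 2 / t := by
  refine (holdingLaw_lt_arrival k (by linarith [k.cast_nonneg (α := ℝ)])).trans ?_
  have h1 : 0 < t - k := by linarith [k.cast_nonneg (α := ℝ)]
  rw [div_le_div_iff₀ (by positivity) ht]
  nlinarith

theorem holdingLaw_arrival_le_two_div {k : ℕ} {t : ℝ} (ht : 0 < t) (hk : 2 * t ≤ k) :
    holdingLaw.real {ξ | arrival k ξ ≤ t} ≤ 2 / t := by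
  refine (holdingLaw_arrival_le k (by linarith)).trans ?_
  have h1 : 0 < k - t := by linarith
  rw [div_le_div_iff₀ (by positivity) ht]
  nlinarith

theorem tendsto_one_sub_inv_pow_floor {T : ℕ → ℝ} (hT : Tendsto T atTop atTop) {s : ℝ}
    (hs : 0 ≤ s) :
    Tendsto (fun n => (1 - 1 / T n) ^ ⌊s * T n⌋₊) atTop (𝓝 (Real.exp (-s))) := by
  have h1 : Tendsto (fun n => (1 + -1 / T n) ^ T n) atTop (𝓝 (Real.exp (-1))) :=
    (Real.tendsto_one_add_div_rpow_exp (-1)).comp hT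
  have h2 : Tendsto (fun n => (⌊s * T n⌋₊ : ℝ) / T n) atTop (𝓝 s) :=
    (tendsto_nat_floor_mul_div_atTop hs).comp hT
  have h3 := h1.rpow h2 (.inl (Real.exp_pos _).ne')
  rw [← Real.exp_mul, neg_one_mul] at h3
  refine h3.congr' ?_
  filter_upwards [hT.eventually_ge_atTop 1] with n hn
  have h4 : 0 ≤ 1 + -1 / T n := by
    rw [neg_div, ← sub_eq_add_neg, sub_nonneg, div_le_one (by linarith)]; exact hn
  rw [← Real.rpow_mul h4, mul_div_cancel₀ _ (by linarith : T n ≠ 0), Real.rpow_natCast,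
    neg_div, ← sub_eq_add_neg]

/-- The uniform weights on decks. -/
def deckWeights (n : ℕ) (x : Deck n) : ℝ := ((tiar n).π x).toReal

theorem invariantWeights_deck (n : ℕ) : InvariantWeights (tiar n).P (deckWeights n) :=
  (tiar n).invariantWeights

theorem mixedAt_tiar {n : ℕ} (hn : n ≠ 0) (m : ℕ) :
    MixedAt (tiar n).P (deckWeights n) m (n * (1 - (n : ℝ)⁻¹) ^ m) :=
  have : NeZero n := ⟨hn⟩
  mixedAt_tiarStep m

theorem deckWeights_eq (n : ℕ) (x : Deck n) : deckWeights n x = (n ! : ℝ)⁻¹ := by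
  simp [deckWeights, tiar, Fintype.card_perm]

theorem mean_deckWeights_ordered (n : ℕ) :
    mean (deckWeights n) ((ordered n).indicator 1) = (n ! : ℝ)⁻¹ := by
  rw [mean_apply, Finset.sum_eq_single 1]
  · simp [ordered, deckWeights_eq]
  · intro x _ hx
    simp [ordered, hx]
  · simp

/-- For fixed `n`, some `m` makes the mixing error smaller than the mass `1/n!` of the goal. -/
theorem summable_mean_survival_tiar {n : ℕ} (hn : 2 ≤ n) {v : Deck n → ℝ} :
    Summable fun k => mean v (survival (tiar n).P (ordered n) k) := by
  have hn0 : (0 : ℝ) < n := by positivity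
  have h1 : Tendsto (fun m : ℕ => n * (1 - (n : ℝ)⁻¹) ^ m) atTop (𝓝 (n * 0)) := by
    refine (tendsto_pow_atTop_nhds_zero_of_lt_one ?_ ?_).const_mul _
    · rw [sub_nonneg]; exact inv_le_one_of_one_le₀ (by exact_mod_cast (by omega : 1 ≤ n))
    · have : 0 < (n : ℝ)⁻¹ := by positivity
      linarith
  rw [mul_zero] at h1
  obtain ⟨m, hm⟩ := (h1.eventually_lt_const
    (show (0 : ℝ) < (n ! : ℝ)⁻¹ by positivity)).exists
  have h2 := (mixedAt_tiar (by omega : n ≠ 0) m).summable_survival (invariantWeights_deck n)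
    (ordered n) (by rwa [mean_deckWeights_ordered])
  simp only [mean_apply]
  exact summable_sum fun x _ => (h2 x).mul_left _

section Exponential

variable {ν : (n : ℕ) → Measure (Deck n)} {m : ℕ → ℕ} {d q : ℕ → ℝ}

theorem meanHittingTime_tiar {n : ℕ} (hn : 2 ≤ n) (ν : Measure (Deck n))
    [IsProbabilityMeasure ν] : meanHittingTime (tiar n).P ν (ordered n)
      = ENNReal.ofReal (∑' k, mean (weights ν) (survival (tiar n).P (ordered n) k)) := by
  rw [meanHittingTime_eq_tsum, ENNReal.ofReal_tsum_of_nonneg (fun k =>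
    (mean_survival_mem_Icc weights_nonneg sum_weights k).1) (summable_mean_survival_tiar hn)]

/-- If the chain is unlikely to visit the ordered deck before mixing, and mixes in a time much
smaller than `n!`, then the hitting time of the ordered deck is asymptotically exponential. -/
theorem asymptoticallyExponential_of_mixedAt (hν : ∀ᶠ n in atTop, IsProbabilityMeasure (ν n))
    (hm : ∀ᶠ n in atTop, MixedAt (tiar n).P (deckWeights n) (m n) (d n))
    (hd : Tendsto d atTop (𝓝 0)) (hq : Tendsto q atTop (𝓝 0))
    (hmn : Tendsto (fun n => (m n : ℝ) / n !) atTop (𝓝 0))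
    (hνq : ∀ᶠ n in atTop, 1 - mean (weights (ν n)) (survival (tiar n).P (ordered n) (m n)) ≤ q n) :
    AsymptoticallyExponential ν := by
  set T : ℕ → ℝ := fun n =>
    ∑' k, mean (weights (ν n)) (survival (tiar n).P (ordered n) k) with hTdef
  have hfac : Tendsto (fun n : ℕ => (n ! : ℝ)) atTop atTop :=
    tendsto_natCast_atTop_atTop.comp
      (tendsto_atTop_mono Nat.self_le_factorial tendsto_id)
  have hsum : ∀ n, 2 ≤ n → HasSum (fun k => mean (weights (ν n))
      (survival (tiar n).P (ordered n) k)) (T n) := fun n hn =>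
    (summable_mean_survival_tiar hn).hasSum
  -- With `K = ⌊n!/4⌋`, the loss `(K + 1)/n!` is at most `1/2`; `d` and `q` take `1/8` each and
  -- leave `1/4`. Since `K ≥ n!/8`, this gives `n!/32`.
  have hTlow : ∀ᶠ n in atTop, (n ! : ℝ) / 32 ≤ T n := by
    filter_upwards [hν, hm, hνq, eventually_ge_atTop 2, hfac.eventually_ge_atTop 8,
      hd.eventually_le_const (show (0 : ℝ) < 1 / 8 by norm_num),
      hq.eventually_le_const (show (0 : ℝ) < 1 / 8 by norm_num)] with n h1 h2 h3 h4 h5 h6 h7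
    have h8 := h2.le_sum_mean_survival (invariantWeights_deck n) weights_nonneg sum_weights h3
      (hsum n h4) ⌊(n ! : ℝ) / 4⌋₊
    rw [mean_deckWeights_ordered] at h8
    set K : ℝ := (⌊(n ! : ℝ) / 4⌋₊ : ℝ)
    have h9 : K ≤ (n ! : ℝ) / 4 := Nat.floor_le (by positivity)
    have h10 : (n ! : ℝ) / 4 < K + 1 := Nat.lt_floor_add_one _
    have h11 : (K + 1) * (n ! : ℝ)⁻¹ ≤ 1 / 2 := by
      rw [← div_eq_mul_inv, div_le_iff₀ (by linarith)]; linarith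
    have h12 : (0 : ℝ) ≤ K := by linarith
    have h13 : K * (1 / 4) ≤ T n :=
      (mul_le_mul_of_nonneg_left (by linarith) h12).trans h8
    linarith
  have hT : Tendsto T atTop atTop :=
    tendsto_atTop_mono' _ hTlow (hfac.atTop_div_const (by norm_num))
  have hmT : Tendsto (fun n => (m n : ℝ) / T n) atTop (𝓝 0) := by
    have h1 := hmn.const_mul 32
    rw [mul_zero] at h1
    refine squeeze_zero' ?_ ?_ h1
    · filter_upwards [hT.eventually_ge_atTop 1] with n hn
      have : 0 ≤ T n := by linarith
      positivity
    · filter_upwards [hTlow] with n hn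
      have h2 : (0 : ℝ) < n ! := by positivity
      calc (m n : ℝ) / T n ≤ m n / (n ! / 32) := by gcongr
        _ = 32 * (m n / n !) := by field_simp
  have hmean : ∀ᶠ n in atTop, meanHittingTime (tiar n).P (ν n) (ordered n)
      = ENNReal.ofReal (T n) := by
    filter_upwards [hν, eventually_ge_atTop 2] with n h1 h2
    exact meanHittingTime_tiar h2 (ν n)
  set η : ℕ → ℝ := fun n => 2 * d n + q n + m n / T n
  have hη : Tendsto η atTop (𝓝 0) := by
    simpa using ((hd.const_mul 2).add hq).add hmT
  have hlim : ∀ s, 0 ≤ s → Tendsto (fun n => mean (weights (ν n))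
      (survival (tiar n).P (ordered n) ⌊s * T n⌋₊)) atTop (𝓝 (Real.exp (-s))) := by
    intro s hs
    have h1 : Tendsto (fun n => η n * (1 + s)) atTop (𝓝 0) := by
      simpa using hη.mul_const (1 + s)
    have h2 := tendsto_one_sub_inv_pow_floor hT hs
    refine h2.congr_dist (squeeze_zero' (.of_forall fun _ => dist_nonneg) ?_ h1)
    filter_upwards [hν, hm, hνq, eventually_ge_atTop 2, hT.eventually_ge_atTop 1]
      with n h1 h2 h3 h4 h5
    have h6 := h2.abs_mean_survival_sub_geometric_le weights_nonneg sum_weights h3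
      (hsum n h4) h5 ⌊s * T n⌋₊
    have hT0 : 0 < T n := by linarith
    have h7 : (⌊s * T n⌋₊ : ℝ) / T n ≤ s := by
      rw [div_le_iff₀ hT0]; exact Nat.floor_le (by positivity)
    have h8 : 0 ≤ η n := by
      have h9 := (abs_nonneg _).trans h6
      exact nonneg_of_mul_nonneg_left h9 (by positivity)
    rw [dist_comm, Real.dist_eq]
    exact h6.trans (mul_le_mul_of_nonneg_left (by linarith) h8)
  refine ⟨?_, fun t ht => ?_⟩
  · filter_upwards [hmean, hT.eventually_ge_atTop 1] with n h1 h2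
    rw [h1]
    exact ⟨ENNReal.ofReal_pos.2 (by linarith), ENNReal.ofReal_lt_top⟩
  set F : ℕ → ℝ := fun n => (law (tiar n).P (ν n)).real
    {ω | ENNReal.ofReal (t * T n) < hittingTime (ordered n) ω} with hF
  have hFeq : ∀ᶠ n in atTop, F n = (law (tiar n).P (ν n)).real
      {ω | ENNReal.ofReal t <
        hittingTime (ordered n) ω / meanHittingTime (tiar n).P (ν n) (ordered n)} := by
    filter_upwards [hmean, hT.eventually_ge_atTop 1] with n h1 h2
    simp only [h1, hF]
    congr 1
    ext ω
    have h3 : ENNReal.ofReal (T n) ≠ 0 := (ENNReal.ofReal_pos.2 (by linarith)).ne'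
    simp only [Set.mem_ofPred_eq]
    rw [ENNReal.lt_div_iff_mul_lt (.inl h3) (.inl ENNReal.ofReal_ne_top),
      ENNReal.ofReal_mul ht]
  refine Tendsto.congr' hFeq ?_
  have hTinv : Tendsto (fun n => (T n)⁻¹) atTop (𝓝 0) := hT.inv_tendsto_atTop
  refine tendsto_order.2 ⟨fun b hb => ?_, fun b hb => ?_⟩
  -- For the lower bound, avoidance is required for about `(t + δ) * T n` jumps, which are unlikely
  -- to occur by time `t * T n`. The upper bound uses `t - δ` similarly.
  · obtain ⟨δ, hδ, hbδ⟩ : ∃ δ > 0, b < Real.exp (-(t + δ)) := by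
      have h1 : Tendsto (fun δ : ℝ => Real.exp (-(t + δ))) (𝓝[>] 0) (𝓝 (Real.exp (-(t + 0)))) :=
        ((Continuous.tendsto (by fun_prop) 0).mono_left nhdsWithin_le_nhds)
      rw [add_zero] at h1
      obtain ⟨δ, h2, h3⟩ := ((h1.eventually_const_lt hb).and self_mem_nhdsWithin).exists
      exact ⟨δ, h3, h2⟩
    have herr : Tendsto (fun n => ((t + δ) * (T n)⁻¹ + (T n)⁻¹ ^ 2) / δ ^ 2) atTop (𝓝 0) := by
      have h1 := ((hTinv.const_mul (t + δ)).add (hTinv.pow 2)).div_const (δ ^ 2)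
      simpa using h1
    have h1 := (hlim (t + δ) (by linarith)).sub herr
    rw [sub_zero] at h1
    filter_upwards [h1.eventually_const_lt hbδ, hν, hT.eventually_ge_atTop 1] with n h2 h3 h4
    have hT0 : 0 < T n := by linarith
    have h5 := survival_le_law_lt_hittingTime (P := (tiar n).P) (ν := ν n) (C := ordered n)
      (t := t * T n) ⌊(t + δ) * T n⌋₊
    set k := ⌊(t + δ) * T n⌋₊
    have h6 : (k : ℝ) ≤ (t + δ) * T n := Nat.floor_le (by positivity)
    have h7 : (t + δ) * T n < k + 1 := Nat.lt_floor_add_one _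
    have h8 : 0 < δ * T n := by positivity
    have h9 := holdingLaw_arrival_le (k + 1) (t := t * T n) (by push_cast; linarith)
    have h10 : ((k + 1 : ℕ) : ℝ) / ((k + 1 : ℕ) - t * T n) ^ 2
        ≤ ((t + δ) * (T n)⁻¹ + (T n)⁻¹ ^ 2) / δ ^ 2 := by
      push_cast
      calc ((k : ℝ) + 1) / (k + 1 - t * T n) ^ 2 ≤ ((t + δ) * T n + 1) / (δ * T n) ^ 2 := by
            gcongr; linarith
        _ = _ := by field_simp
    simp only [hF]
    linarith
  -- At `t = 0` there is no room for `δ < t`, but the limit is one and probabilities do not exceed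
  -- it.
  · rcases ht.eq_or_lt with rfl | ht0
    · filter_upwards [hν] with n hn
      rw [neg_zero, Real.exp_zero] at hb
      exact measureReal_le_one.trans_lt hb
    obtain ⟨δ, hδ, hδt, hbδ⟩ : ∃ δ > 0, δ < t ∧ Real.exp (-(t - δ)) < b := by
      have h1 : Tendsto (fun δ : ℝ => Real.exp (-(t - δ))) (𝓝[>] 0) (𝓝 (Real.exp (-(t - 0)))) :=
        ((Continuous.tendsto (by fun_prop) 0).mono_left nhdsWithin_le_nhds)
      rw [sub_zero] at h1
      obtain ⟨δ, ⟨h2, h3⟩, h4⟩ := (((h1.eventually_lt_const hb).and self_mem_nhdsWithin).and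
        (nhdsWithin_le_nhds (eventually_lt_nhds ht0))).exists
      exact ⟨δ, h3, h4, h2⟩
    have herr : Tendsto (fun n => t * (T n)⁻¹ / δ ^ 2) atTop (𝓝 0) := by
      simpa using (hTinv.const_mul t).div_const (δ ^ 2)
    have h1 := (hlim (t - δ) (by linarith)).add herr
    rw [add_zero] at h1
    filter_upwards [h1.eventually_lt_const hbδ, hν, hT.eventually_ge_atTop 1] with n h2 h3 h4
    have hT0 : 0 < T n := by linarith
    have h5 := law_lt_hittingTime_le (P := (tiar n).P) (ν := ν n) (C := ordered n)
      (t := t * T n) ⌊(t - δ) * T n⌋₊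
    set k := ⌊(t - δ) * T n⌋₊
    have h6 : (k : ℝ) ≤ (t - δ) * T n := Nat.floor_le (mul_nonneg (by linarith) hT0.le)
    have h8 : 0 < δ * T n := by positivity
    have h9 := holdingLaw_lt_arrival k (t := t * T n) (by linarith)
    have h10 : (k : ℝ) / (t * T n - k) ^ 2 ≤ t * (T n)⁻¹ / δ ^ 2 := by
      calc (k : ℝ) / (t * T n - k) ^ 2 ≤ (t * T n) / (δ * T n) ^ 2 := by
            gcongr <;> linarith
        _ = _ := by field_simp
    simp only [hF]
    linarith

end Exponential

/-! ### The hypotheses `Hp.G` for the top-in-at-random shuffle -/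

section General

theorem InvariantWeights.one_sub_mean_survival_ceil_le {S : Type} [Fintype S]
    {P : S → PMF S} {w : S → ℝ} {C : Set S} {R : ℝ} (hw : InvariantWeights P w)
    (hR : 0 < R) :
    1 - mean w (survival P C ⌈4 * R⌉₊) ≤ (4 * R + 2) * mean w (C.indicator 1) := by
  refine (hw.one_sub_mean_survival_le C _).trans ?_
  have h1 := Nat.ceil_lt_add_one (show 0 ≤ 4 * R by linarith)
  exact mul_le_mul_of_nonneg_right (by linarith)
    (mean_nonneg hw.nonneg (Set.indicator_nonneg fun _ _ => zero_le_one))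

variable {S : Type} [Fintype S] [MeasurableSpace S] [DiscreteMeasurableSpace S]
  {P : S → PMF S} {w : S → ℝ} {C : Set S} {R : ℝ}

/-- Twice the expected number `2R` of jumps is a safe cap: Chebyshev's inequality gives the error `2
/ (2R)`. -/
theorem hitProb_two_mul_le {ν : Measure S} [IsProbabilityMeasure ν] (hR : 0 < R) :
    hitProb P ν C (2 * R) ≤ (1 - mean (weights ν) (survival P C ⌈4 * R⌉₊)) + 1 / R := by
  refine (hitProb_le ⌈4 * R⌉₊).trans ?_
  have h := holdingLaw_arrival_le_two_div (k := ⌈4 * R⌉₊ + 1) (t := 2 * R) (by linarith)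
    (by push_cast; linarith [Nat.le_ceil (4 * R)])
  rw [show 2 / (2 * R) = 1 / R by field_simp] at h
  linarith

/-- The stationary average of the hitting probabilities. -/
theorem InvariantWeights.mean_hitProb_le (hw : InvariantWeights P w) (hR : 0 < R) :
    mean w (fun x => hitProb P (Measure.dirac x) C (2 * R))
      ≤ (4 * R + 2) * mean w (C.indicator 1) + 1 / R := by
  have h1 : (fun x => hitProb P (Measure.dirac x) C (2 * R))
      ≤ (fun _ => 1 + 1 / R) - survival P C ⌈4 * R⌉₊ := by
    intro x
    have := hitProb_two_mul_le (P := P) (ν := Measure.dirac x) (C := C) hR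
    rw [mean_weights_dirac] at this
    simp only [Pi.sub_apply]
    linarith
  have h2 := mean_mono hw.nonneg h1
  rw [map_sub, mean_const hw.sum_eq_one] at h2
  linarith [hw.one_sub_mean_survival_ceil_le (C := C) hR]

/-- The basin has nearly full measure outside of the goal set. -/
theorem mean_compl_basin_le (M : StationaryChain S) (G : Set S) {α f : ℝ} (hR : 0 < R)
    (hf : 0 < f) (hwf : (4 * R + 2) * mean (fun x => (M.π x).toReal) (G.indicator 1) + 1 / R ≤ f) :
    mean (fun x => (M.π x).toReal) ((basin M G α R f ∪ G)ᶜ.indicator 1) ≤ f ^ (1 - α) := by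
  set w : S → ℝ := fun x => (M.π x).toReal
  have hw : InvariantWeights M.P w := M.invariantWeights
  have hw' : InvariantWeights M.reversed w := M.invariantWeights_reversed
  have h1 := hw.mean_hitProb_le (C := G) hR
  have h2 := hw'.mean_hitProb_le (C := G) hR
  have hfα : 0 < f ^ α := Real.rpow_pos_of_pos hf α
  set u : S → ℝ := fun x => hitProb M.P (Measure.dirac x) G (2 * R) with hu
  set u' : S → ℝ := fun x => hitProb M.reversed (Measure.dirac x) G (2 * R) with hu'
  have hu0 : ∀ x, 0 ≤ u x := fun x => measureReal_nonneg
  have hu0' : ∀ x, 0 ≤ u' x := fun x => measureReal_nonneg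
  -- This is Markov's inequality: outside the basin and the goal the half-sum exceeds `f ^ α`, while
  -- its mean is at most `f`.
  have h3 : f ^ α • (basin M G α R f ∪ G)ᶜ.indicator (1 : S → ℝ)
      ≤ (1 / 2 : ℝ) • (u + u') := by
    intro x
    by_cases hx : x ∈ (basin M G α R f ∪ G)ᶜ
    · simp only [Pi.smul_apply, Set.indicator_of_mem hx, Pi.one_apply, smul_eq_mul, mul_one,
        Pi.add_apply]
      by_contra! h
      exact hx (by_contra fun hxu => hxu (.inl ⟨fun hG => hxu (.inr hG), h.le⟩))
    · simp only [Pi.smul_apply, Set.indicator_of_notMem hx, smul_eq_mul, mul_zero, Pi.add_apply]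
      linarith [hu0 x, hu0' x]
  have h4 := mean_mono hw.nonneg h3
  rw [map_smul, map_smul, map_add, smul_eq_mul, smul_eq_mul] at h4
  rw [Real.rpow_sub hf, Real.rpow_one, le_div_iff₀ hfα, mul_comm]
  linarith

/-- If `D` is missed up to time `R`, either fewer than `m` jumps have occurred or the nearly
stationary state after `m` jumps lies outside `D`. -/
theorem MixedAt.law_lt_hittingTime_le {m : ℕ} {d : ℝ} (hm : MixedAt P w m d) (hR : 0 < R)
    (hmR : 2 * m ≤ R) (D : Set S) (x : S) :
    (lawAt P x).real {ω | ENNReal.ofReal R < hittingTime D ω}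
      ≤ mean w (Dᶜ.indicator 1) + d + 2 / R := by
  have h1 := Metastable.law_lt_hittingTime_le (P := P) (ν := Measure.dirac x) (C := D) (t := R) m
  rw [mean_weights_dirac] at h1
  have h2 := killedOp_pow_le P D m (indicator_compl_one_nonneg D) x
  have h3 := (abs_le.1 (hm _ ⟨indicator_compl_one_nonneg D, indicator_one_le Dᶜ⟩ x)).2
  have h4 := holdingLaw_lt_arrival_le_two_div hR hmR
  simp only [survival] at h1
  simp only [lawAt]
  linarith

/-- From the basin, the goal set is unlikely to be visited during the first `m` jumps. -/
theorem one_sub_mean_survival_le_of_basin (M : StationaryChain S) (G : Set S) {α f : ℝ} {m : ℕ}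
    (hR : 0 < R) (hmR : 2 * m ≤ R) {ν : Measure S} [IsProbabilityMeasure ν]
    (hν : ν (basin M G α R f)ᶜ = 0) :
    1 - mean (weights ν) (survival M.P G m) ≤ 2 * f ^ α + 2 / R := by
  have h1 : mean (weights ν) (1 - survival M.P G m) ≤
      mean (weights ν) (fun _ => 2 * f ^ α + 2 / R) := by
    refine Finset.sum_le_sum fun x _ => ?_
    by_cases hx : x ∈ basin M G α R f
    · refine mul_le_mul_of_nonneg_left ?_ (weights_nonneg x)
      have h2 := one_sub_survival_le (P := M.P) (ν := Measure.dirac x) (C := G) (t := 2 * R) m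
      rw [mean_weights_dirac] at h2
      have h3 := holdingLaw_lt_arrival_le_two_div (k := m) (t := 2 * R) (by linarith) (by linarith)
      have h4 : 2 / (2 * R) ≤ 2 / R := by gcongr; linarith
      -- Dropping the reversed term from the half-sum that defines the basin produces the factor
      -- `2`.
      have h5 : 0 ≤ hitProb M.reversed (Measure.dirac x) G (2 * R) := measureReal_nonneg
      have h6 := hx.2
      simp only [Pi.sub_apply, Pi.one_apply]
      linarith
    · have : weights ν x = 0 := by
        rw [weights, measureReal_eq_zero_iff]
        exact measure_mono_null (Set.singleton_subset_iff.2 hx) hν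
      simp [this]
  rwa [map_sub, mean_one sum_weights, mean_const sum_weights] at h1

end General

/-- The precision of the mixing after `⌊R / 2⌋` steps vanishes when `R ≫ n log n`. -/
theorem tendsto_mixing {R : ℕ → ℝ} (hR : ∀ n, 0 < R n)
    (hlow : Tendsto (fun n : ℕ => (n * Real.log n) / R n) atTop (𝓝 0)) :
    Tendsto (fun n : ℕ => n * (1 - (n : ℝ)⁻¹) ^ ⌊R n / 2⌋₊) atTop (𝓝 0) := by
  have h1 : Tendsto (fun n : ℕ => Real.exp 1 * (n : ℝ)⁻¹) atTop (𝓝 0) := by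
    simpa using tendsto_inv_atTop_nhds_zero_nat.const_mul (Real.exp 1)
  refine squeeze_zero' ?_ ?_ h1
  · filter_upwards [eventually_ge_atTop 1] with n hn
    have : (n : ℝ)⁻¹ ≤ 1 := inv_le_one_of_one_le₀ (by exact_mod_cast hn)
    exact mul_nonneg n.cast_nonneg (pow_nonneg (by linarith) _)
  · filter_upwards [eventually_ge_atTop 1,
      hlow.eventually_le_const (show (0 : ℝ) < 1 / 4 by norm_num)] with n hn h2
    have hn0 : (0 : ℝ) < n := by exact_mod_cast hn
    have hn1 : (n : ℝ)⁻¹ ≤ 1 := inv_le_one_of_one_le₀ (by exact_mod_cast hn)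
    rw [div_le_iff₀ (hR n)] at h2
    have h3 : R n / 2 < ⌊R n / 2⌋₊ + 1 := Nat.lt_floor_add_one _
    set m := ⌊R n / 2⌋₊
    -- Eventually `R n ≥ 4 n log n`, hence `m > 2 n log n - 1`. Half of this beats the prefactor
    -- `n`, and the rest gives decay of order `1/n`.
    have h4 : 2 * Real.log n - 1 ≤ m * (n : ℝ)⁻¹ := by
      have h5 : 2 * Real.log n * n - 1 ≤ m := by linarith
      have h6 := mul_le_mul_of_nonneg_right h5 (inv_nonneg.2 hn0.le)
      rw [sub_mul, mul_assoc, mul_inv_cancel₀ hn0.ne', mul_one, one_mul] at h6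
      linarith
    calc n * (1 - (n : ℝ)⁻¹) ^ m ≤ n * Real.exp (-(n : ℝ)⁻¹) ^ m := by
          have h5 := Real.one_sub_le_exp_neg (n : ℝ)⁻¹
          have h6 : 0 ≤ 1 - (n : ℝ)⁻¹ := by linarith
          gcongr
      _ = Real.exp (Real.log n - m * (n : ℝ)⁻¹) := by
          rw [← Real.exp_nat_mul, Real.exp_sub, Real.exp_log hn0, mul_neg, Real.exp_neg]; rfl
      _ ≤ Real.exp (1 - Real.log n) := Real.exp_le_exp.2 (by linarith)
      _ = Real.exp 1 * (n : ℝ)⁻¹ := by rw [Real.exp_sub, Real.exp_log hn0]; rfl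

theorem tendsto_inv_of_mul_log_div {R : ℕ → ℝ} (hR : ∀ n, 0 < R n)
    (hlow : Tendsto (fun n : ℕ => (n * Real.log n) / R n) atTop (𝓝 0)) :
    Tendsto (fun n => 1 / R n) atTop (𝓝 0) := by
  refine squeeze_zero' (.of_forall fun n => (one_div_pos.2 (hR n)).le) ?_ hlow
  filter_upwards [eventually_ge_atTop 3] with n hn
  have h1 : (3 : ℝ) ≤ n := by exact_mod_cast hn
  have h2 : 1 ≤ Real.log n := by
    rw [Real.le_log_iff_exp_le (by linarith)]
    linarith [Real.exp_one_lt_d9]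
  exact div_le_div_of_nonneg_right (by nlinarith) (hR n).le

theorem tendsto_div_factorial {R : ℕ → ℝ} (hR : ∀ n, 0 < R n)
    (hup : Tendsto (fun n : ℕ => R n / ((n - 2)! : ℕ)) atTop (𝓝 0)) :
    Tendsto (fun n => R n / (n ! : ℝ)) atTop (𝓝 0) := by
  refine squeeze_zero (fun n => div_nonneg (hR n).le (Nat.cast_nonneg _)) (fun n => ?_) hup
  have h1 : ((n - 2)! : ℝ) ≤ n ! := by exact_mod_cast Nat.factorial_le (Nat.sub_le n 2)
  have h2 : (0 : ℝ) < (n - 2)! := by positivity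
  exact div_le_div_of_nonneg_left (hR n).le h2 h1

/-! ### The uniform law on the decks that are not ordered -/

theorem measure_compl_ordered (n : ℕ) :
    (tiar n).π.toMeasure.real (ordered n)ᶜ = 1 - (n ! : ℝ)⁻¹ := by
  rw [probReal_compl_eq_one_sub .of_discrete, ordered, measureReal_def,
    PMF.toMeasure_apply_singleton _ _ (.of_discrete)]
  rw [show ((tiar n).π 1).toReal = (n ! : ℝ)⁻¹ from deckWeights_eq n 1]

theorem isProbabilityMeasure_restricted {n : ℕ} (hn : 2 ≤ n) :
    IsProbabilityMeasure ((tiar n).restricted (ordered n)ᶜ) := by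
  refine cond_isProbabilityMeasure fun h => ?_
  have h1 := measure_compl_ordered n
  have h2 : (2 : ℝ) ≤ n ! := by exact_mod_cast hn.trans n.self_le_factorial
  have h3 : (n ! : ℝ)⁻¹ ≤ 2⁻¹ := inv_anti₀ two_pos h2
  rw [measureReal_def, h, ENNReal.toReal_zero] at h1
  linarith

/-- Conditioning on the complement of the goal multiplies the weights by at most `1 / (1 - 1/n!) ≤
2`. -/
theorem one_sub_mean_restricted_le {n : ℕ} (hn : 2 ≤ n) (k : ℕ) :
    1 - mean (weights ((tiar n).restricted (ordered n)ᶜ)) (survival (tiar n).P (ordered n) k)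
      ≤ 2 * (1 - mean (deckWeights n) (survival (tiar n).P (ordered n) k)) := by
  have := isProbabilityMeasure_restricted hn
  have h2 : (2 : ℝ) ≤ n ! := by exact_mod_cast hn.trans n.self_le_factorial
  have h3 : (n ! : ℝ)⁻¹ ≤ 2⁻¹ := inv_anti₀ two_pos h2
  have h4 : weights ((tiar n).restricted (ordered n)ᶜ) ≤ fun x => 2 * deckWeights n x := by
    intro x
    have h5 : (tiar n).π.toMeasure.real ((ordered n)ᶜ ∩ {x}) ≤ deckWeights n x := by
      refine (measureReal_mono Set.inter_subset_right).trans_eq ?_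
      rw [measureReal_def, PMF.toMeasure_apply_singleton _ _ (.of_discrete)]
      rfl
    rw [weights, StationaryChain.restricted, measureReal_def, cond_apply .of_discrete,
      ENNReal.toReal_mul, ENNReal.toReal_inv]
    change ((tiar n).π.toMeasure.real (ordered n)ᶜ)⁻¹
      * (tiar n).π.toMeasure.real ((ordered n)ᶜ ∩ {x}) ≤ _
    rw [measure_compl_ordered]
    have h6 : (1 - (n ! : ℝ)⁻¹)⁻¹ ≤ 2 := by
      rw [inv_le_comm₀ (by linarith) two_pos]; linarith
    exact mul_le_mul h6 h5 measureReal_nonneg two_pos.le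
  have h5 : mean (weights ((tiar n).restricted (ordered n)ᶜ))
      (1 - survival (tiar n).P (ordered n) k)
      ≤ 2 * mean (deckWeights n) (1 - survival (tiar n).P (ordered n) k) := by
    rw [mean_apply, mean_apply, Finset.mul_sum]
    refine Finset.sum_le_sum fun x _ => ?_
    rw [← mul_assoc]
    exact mul_le_mul_of_nonneg_right (h4 x) (sub_nonneg.2 (survival_le_one _ _ k x))
  rwa [map_sub, map_sub, mean_one sum_weights, mean_one (invariantWeights_deck n).sum_eq_one] at h5

end Metastable

end

/-! ### Choice of the parameters and proof of the theorem -/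

open Metastable in
theorem theorem4p5 (R : ℕ → ℝ) (hR : ∀ n, 0 < R n)
    (hlow : Tendsto (fun n : ℕ => (n * Real.log n) / R n) atTop (𝓝 0))
    (hup : Tendsto (fun n : ℕ => R n / ((n - 2)! : ℕ)) atTop (𝓝 0)) :
    (∃ f d : ℕ → ℝ, Tendsto f atTop (𝓝 0) ∧ Tendsto d atTop (𝓝 0) ∧
      ∀ α : ℝ, 0 < α → α < 1 →
        (∃ r : ℕ → ℝ, Tendsto r atTop (𝓝 0) ∧
          ∀ᶠ n in atTop, HpG (tiar n) (ordered n) α (R n) (d n) (f n) (r n)) ∧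
        ∀ ν : (n : ℕ) → Measure (Deck n), (∀ n, IsProbabilityMeasure (ν n)) →
          (∀ᶠ n in atTop, ν n (basin (tiar n) (ordered n) α (R n) (f n))ᶜ = 0) →
          AsymptoticallyExponential ν) ∧
    AsymptoticallyExponential (fun n => (tiar n).restricted (ordered n)ᶜ) := by
  -- Half the expected number of jumps by time `R n`: enough to mix, and completed by then except
  -- with probability at most `2 / R n`.
  set m : ℕ → ℕ := fun n => ⌊R n / 2⌋₊
  set e : ℕ → ℝ := fun n => n * (1 - (n : ℝ)⁻¹) ^ m n with he
  have hmR : ∀ n, 2 * (m n : ℝ) ≤ R n := fun n => by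
    have : (m n : ℝ) ≤ R n / 2 := Nat.floor_le (by linarith [hR n])
    linarith
  have hmix : ∀ᶠ n in atTop, MixedAt (tiar n).P (deckWeights n) (m n) (e n) := by
    filter_upwards [eventually_ge_atTop 1] with n hn using mixedAt_tiar (by omega) (m n)
  have he0 : Tendsto e atTop (𝓝 0) := tendsto_mixing hR hlow
  have henn : ∀ᶠ n in atTop, 0 ≤ e n := by
    filter_upwards [hmix] with n hn
    exact (abs_nonneg _).trans (hn 0 ⟨le_rfl, fun _ => zero_le_one⟩ 1)
  have hRinv : Tendsto (fun n => 1 / R n) atTop (𝓝 0) := tendsto_inv_of_mul_log_div hR hlow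
  have hRinv2 : Tendsto (fun n => 2 / R n) atTop (𝓝 0) := by
    simpa [div_eq_mul_inv] using hRinv.const_mul 2
  have hRfac : Tendsto (fun n => R n / (n ! : ℝ)) atTop (𝓝 0) := tendsto_div_factorial hR hup
  have hfac : Tendsto (fun n : ℕ => (n ! : ℝ)⁻¹) atTop (𝓝 0) :=
    (tendsto_natCast_atTop_atTop.comp
      (tendsto_atTop_mono Nat.self_le_factorial tendsto_id)).inv_tendsto_atTop
  have hmfac : Tendsto (fun n => (m n : ℝ) / n !) atTop (𝓝 0) := by
    refine squeeze_zero (fun n => by positivity) (fun n => ?_) hRfac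
    exact div_le_div_of_nonneg_right (by linarith [hmR n, (m n).cast_nonneg (α := ℝ)])
      (Nat.cast_nonneg _)
  -- The first term is the union bound over the jumps in time `2 * R n`, doubled because slow escape
  -- starts from the conditioned law; `1 / R n` is the clock error.
  set f : ℕ → ℝ := fun n => 2 * ((4 * R n + 2) * (n ! : ℝ)⁻¹) + 1 / R n with hf
  have hf0 : Tendsto f atTop (𝓝 0) := by
    have h1 := (((hRfac.const_mul 8).add (hfac.const_mul 4)).add hRinv)
    simp only [mul_zero, add_zero] at h1
    refine h1.congr fun n => ?_
    simp only [hf]; ring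
  have hfpos : ∀ n, 0 < f n := fun n => by
    have := hR n
    positivity
  set d : ℕ → ℝ := fun n => 2 * (e n + 2 / R n) with hd
  have hd0 : Tendsto d atTop (𝓝 0) := by
    simpa using (he0.add hRinv2).const_mul 2
  -- The recurrence bound has `2 / R n`; taking `3 / R n` makes the required inequality strict.
  refine ⟨⟨f, d, hf0, hd0, fun α hα0 hα1 => ⟨⟨fun n => f n ^ (1 - α) + e n + 3 / R n, ?_, ?_⟩,
    fun ν hν hνB => ?_⟩⟩, ?_⟩
  · have h1 := hf0.rpow_const (p := 1 - α) (.inr (by linarith))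
    rw [Real.zero_rpow (by linarith)] at h1
    have h2 := (h1.add he0).add (hRinv.const_mul 3)
    simpa [div_eq_mul_inv] using h2
  · have h1 := hf0.rpow_const (p := 1 - α) (.inr (by linarith))
    rw [Real.zero_rpow (by linarith)] at h1
    have hr0 : Tendsto (fun n => f n ^ (1 - α) + e n + 3 / R n) atTop (𝓝 0) := by
      have h2 := (h1.add he0).add (hRinv.const_mul 3)
      simpa [div_eq_mul_inv] using h2
    filter_upwards [hmix, henn, hf0.eventually_lt_const one_pos, hd0.eventually_lt_const one_pos,
      hr0.eventually_lt_const one_pos, hRinv.eventually_lt_const one_pos, eventually_ge_atTop 2]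
      with n hn1 hn2 hn3 hn4 hn5 hn6 hn7
    have hRn := hR n
    have hG := mean_deckWeights_ordered n
    have hfn : (4 * R n + 2) * (n ! : ℝ)⁻¹ + 1 / R n ≤ f n := by
      have : 0 ≤ (4 * R n + 2) * (n ! : ℝ)⁻¹ := by positivity
      simp only [hf]; linarith
    refine ⟨?_, ⟨by positivity, hn4⟩, ⟨hfpos n, hn3⟩, ⟨?_, hn5⟩, ?_, ?_, ?_⟩
    · rwa [div_lt_one hRn] at hn6
    · have := Real.rpow_pos_of_pos (hfpos n) (1 - α)
      positivity
    · have := isProbabilityMeasure_restricted hn7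
      refine (hitProb_two_mul_le hRn).trans ?_
      have h2 := one_sub_mean_restricted_le hn7 ⌈4 * R n⌉₊
      have h3 := (invariantWeights_deck n).one_sub_mean_survival_ceil_le (C := ordered n) hRn
      rw [hG] at h3
      simp only [hf]
      linarith
    -- The mixing bound is uniform over all starting decks, in particular over the basin.
    · intro x _ x' _
      refine (hn1.evolvedTV_le (invariantWeights_deck n) (R n) x x').trans ?_
      have := holdingLaw_lt_arrival_le_two_div hRn (hmR n)
      simp only [hd]
      linarith
    · intro x
      refine (hn1.law_lt_hittingTime_le hRn (hmR n) _ x).trans_lt ?_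
      have h2 := mean_compl_basin_le (tiar n) (ordered n) (α := α) hRn (hfpos n)
        (by
          change (4 * R n + 2) * mean (deckWeights n) _ + _ ≤ _
          rwa [hG])
      change mean (deckWeights n) _ ≤ _ at h2
      have h3 : 2 / R n < 3 / R n := by gcongr; norm_num
      linarith
  · have hq : Tendsto (fun n => 2 * f n ^ α + 2 / R n) atTop (𝓝 0) := by
      have h1 := hf0.rpow_const (p := α) (.inr hα0.le)
      rw [Real.zero_rpow hα0.ne'] at h1
      simpa using (h1.const_mul 2).add hRinv2
    refine asymptoticallyExponential_of_mixedAt (.of_forall hν) hmix he0 hq hmfac ?_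
    filter_upwards [hνB] with n hn
    have := hν n
    exact one_sub_mean_survival_le_of_basin (tiar n) (ordered n) (hR n) (hmR n) hn
  -- From the conditioned law, an early visit is controlled by the stationary union bound over steps
  -- `0, …, m n`, doubled by the conditioning.
  · have hq : Tendsto (fun n => 2 * (((m n : ℝ) + 1) * (n ! : ℝ)⁻¹)) atTop (𝓝 0) := by
      have h1 := (hmfac.add hfac).const_mul 2
      simp only [mul_zero, add_zero] at h1
      refine h1.congr fun n => ?_
      ring
    refine asymptoticallyExponential_of_mixedAt ?_ hmix he0 hq hmfac ?_
    · filter_upwards [eventually_ge_atTop 2] with n hn using isProbabilityMeasure_restricted hn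
    · filter_upwards [eventually_ge_atTop 2] with n hn
      refine (one_sub_mean_restricted_le hn (m n)).trans ?_
      have h1 := (invariantWeights_deck n).one_sub_mean_survival_le (ordered n) (m n)
      rw [mean_deckWeights_ordered] at h1
      linarith
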